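/- **Quantitative Sturm bound for $\mathrm{SL}_2$.** Let $\mathbf A=\mathbf A_f\times\mathbf R$ be the adele ring of $\mathbf Q$, and let $\widetilde{\mathrm{SL}}_2$ denote the metaplectic double cover of $\mathrm{SL}_2$. Let $G$ be one of $\mathrm{SL}_2,\ \widetilde{\mathrm{SL}}_2$, and let $K\subseteq G(\mathbf A_f)$ be $\mathrm{SL}_2(\widehat{\mathbf Z})$, respectively its inverse image in $\widetilde{\mathrm{SL}}_2(\mathbf A_f)$. Let $\ell'\in\frac12\mathbf Z$, with $\ell'\in\mathbf Z$ if $G=\mathrm{SL}_2$. For $d\in\mathbf Q_{>0}$ and $g_\infty\in G(\mathbf R)$ with image $\begin{pmatrix}a&b\\c&e\end{pmatrix}\in\mathrm{SL}_2(\mathbf R)$ put $$\mathcal W_{\ell',d}(g_\infty)=j_{1/2}(g_\infty,i)^{-2\ell'}\,e^{2\pi i d\,(g_\infty\cdot i)},$$ where $j_{1/2}(g_\infty,z)$ is the canonical square root of $cz+e$ on $\widetilde{\mathrm{SL}}_2(\mathbf R)$ (for $G=\mathrm{SL}_2$, where $\ell'$ is an integer, $j_{1/2}^{-2\ell'}$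 means $(cz+e)^{-\ell'}$). There are positive constants $A_{\ell'},B_{\ell'}$, depending only on $\ell'$, such that the following holds. Let $\varphi$ be a cuspidal automorphic form on $G(\mathbf A)$ that corresponds to a holomorphic modular form of weight $\ell'$, with (absolutely convergent) Fourier expansion $$\varphi(g_fg_\infty)=\sum_{d\in\mathbf Q_{>0}} b_d(g_f)\,\mathcal W_{\ell',d}(g_\infty)\qquad(g_f\in G(\mathbf A_f),\ g_\infty\in G(\mathbf R)),$$ and let $\beta_d(g_f)=d^{-\ell'/2}b_d(g_f)$ be its normalized Fourier coefficients. Let $M\ge1$ be an integer such that, for $k\in K$ and $d\in\mathbf Q_{>0}$, $b_d(k)\ne0$ implies $d\in M^{-1}\mathbf Z$. Let $\epsilon$ be a real number with $$|\beta_d(k)|\le\epsilon\quad\text{for all } k\in K \text{ and all } d\in\mathbf Q_{>0} \text{ with } d<\frac{\log M}{\pi}+A_{\ell'}.$$ Then $|\beta_d(g_f)|\le\epsilon\,B_{\ell'}\,M$ for all $d\in\mathbf Q_{>0}$ and all $g_f\in G(\mathbf A_f)$. -/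

import Mathlib

open IsDedekindDomain

namespace SturmSL2

/-! ### Adeles of `ℚ`

The adele ring of `ℚ` is written as the product of the finite adeles and of `ℝ`. -/

/-- The ring of finite adeles of `ℚ`. -/
abbrev FinAdele : Type := FiniteAdeleRing ℤ ℚ

/-- The finite places of `ℚ`. -/
abbrev Place : Type := HeightOneSpectrum ℤ

/-- The completion of `ℚ` at a finite place. -/
abbrev Completion (v : Place) : Type := v.adicCompletion ℚ

/-- The group `SL₂(R)`. -/
abbrev SL2 (R : Type) [CommRing R] : Type := Matrix.SpecialLinearGroup (Fin 2) R

/-- The projection from the finite adeles to the completion at `v`. -/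
noncomputable def proj (v : Place) : FinAdele →+* Completion v where
  toFun x := x v
  map_one' := rfl
  map_mul' _ _ := rfl
  map_zero' := rfl
  map_add' _ _ := rfl

/-- The component at `v` of an element of `SL₂(𝔸_f)`. -/
noncomputable def component (v : Place) (g : SL2 FinAdele) : SL2 (Completion v) :=
  Matrix.SpecialLinearGroup.map (proj v) g

/-- The subset `SL₂(ℤ̂)` of `SL₂(𝔸_f)`. -/
def integralSL2 : Set (SL2 FinAdele) :=
  {g | ∀ (v : Place) (i j : Fin 2), g i j v ∈ v.adicCompletionIntegers ℚ}

/-- The diagonal embedding `SL₂(ℚ) → SL₂(𝔸_f)`. -/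
noncomputable def ratToFin (γ : SL2 ℚ) : SL2 FinAdele :=
  Matrix.SpecialLinearGroup.map (algebraMap ℚ FinAdele) γ

/-- The embedding `SL₂(ℚ) → SL₂(ℝ)`. -/
noncomputable def ratToReal (γ : SL2 ℚ) : SL2 ℝ :=
  Matrix.SpecialLinearGroup.map (algebraMap ℚ ℝ) γ

/-- The upper triangular unipotent matrix with upper right entry `x`. -/
def unipotent {R : Type} [CommRing R] (x : R) : SL2 R :=
  ⟨!![1, x; 0, 1], by simp⟩

/-- The fundamental domain `ℤ̂ × [0, 1)` for the quotient of the adeles by `ℚ`. -/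
def adelicBox : Set (FinAdele × ℝ) :=
  {x | (∀ v : Place, x.1 v ∈ v.adicCompletionIntegers ℚ) ∧ x.2 ∈ Set.Ico (0 : ℝ) 1}

/-- The integral over `ℚ \ 𝔸` of a `ℚ`-periodic function on the adeles is zero. The integral is
taken over a fundamental domain, with respect to any additive Haar measure. -/
def IntegralVanishes (f : FinAdele × ℝ → ℂ) : Prop :=
  letI : MeasurableSpace (FinAdele × ℝ) := borel (FinAdele × ℝ)
  ∀ μ : MeasureTheory.Measure (FinAdele × ℝ), μ.IsAddHaarMeasure →
    ∫ x in adelicBox, f x ∂μ = 0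

/-! ### The metaplectic double cover

The metaplectic group is described by its standard two-cocycle (due to Kubota): at each place `v`
the local double cover is `SL₂(ℚ_v) × {±1}` with multiplication twisted by a product of Hilbert
symbols. At the finite places the cocycle is modified by the coboundary of the function
`splitSign`; after this it is trivial on `SL₂(ℤ_p) × SL₂(ℤ_p)` for odd `p` (and, at `p = 2`, on the
group of integral matrices that are upper unipotent modulo `4`). Hence for two elements of
`SL₂(𝔸_f)` almost all local cocycles are `1`, and the product over all places defines the double
cover of `SL₂(𝔸)`. -/

open Classical in
/-- The Hilbert symbol of a field `F`: for `a, b ≠ 0` it is `1` if `z² = a x² + b y²` has a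
nonzero solution and `-1` otherwise. -/
noncomputable def hilbertSymbol {F : Type} [Field F] (a b : F) : ℤˣ :=
  if ∃ x y z : F, (x ≠ 0 ∨ y ≠ 0 ∨ z ≠ 0) ∧ z ^ 2 = a * x ^ 2 + b * y ^ 2 then 1 else -1

open Classical in
/-- For a matrix with lower row `(c, d)`: the entry `c` if it is nonzero, and `d` otherwise. -/
noncomputable def lowerEntry {F : Type} [Field F] (g : SL2 F) : F :=
  if g 1 0 ≠ 0 then g 1 0 else g 1 1

/-- Kubota's two-cocycle on `SL₂(F)`, for a local field `F`. -/
noncomputable def kubota {F : Type} [Field F] (g h : SL2 F) : ℤˣ :=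
  hilbertSymbol (lowerEntry g) (lowerEntry h) *
    hilbertSymbol (-(lowerEntry g * lowerEntry h)) (lowerEntry (g * h))

open Classical in
/-- For a matrix with lower row `(c, d)` over `ℚ_p`: the Hilbert symbol of `c` and `d` if `c` and
`d` are nonzero and the valuation of `c` is odd, and `1` otherwise. -/
noncomputable def splitSign (v : Place) (g : SL2 (Completion v)) : ℤˣ :=
  if g 1 0 ≠ 0 ∧ g 1 1 ≠ 0 ∧ Odd (WithZero.log (Valued.v (g 1 0))) then
    hilbertSymbol (g 1 0) (g 1 1) else 1

/-- The normalized two-cocycle at a finite place. -/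
noncomputable def localCocycle (v : Place) (g h : SL2 (Completion v)) : ℤˣ :=
  kubota g h * (splitSign v g * splitSign v h * splitSign v (g * h))

/-- The two-cocycle on `SL₂(𝔸_f)`: the product of the normalized local cocycles. -/
noncomputable def finCocycle (g h : SL2 FinAdele) : ℤˣ :=
  ∏ᶠ v : Place, localCocycle v (component v g) (component v h)

/-- The metaplectic double cover of `SL₂(𝔸_f)`. -/
structure MpFin where
  mat : SL2 FinAdele
  sgn : ℤˣ

/-- The metaplectic double cover of `SL₂(ℝ)`. -/
structure MpReal where
  mat : SL2 ℝ
  sgn : ℤˣ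

/-- The metaplectic double cover of `SL₂(𝔸)`. -/
structure MpAdele where
  fin : SL2 FinAdele
  inf : SL2 ℝ
  sgn : ℤˣ

noncomputable instance : Mul MpFin :=
  ⟨fun g h => ⟨g.mat * h.mat, g.sgn * h.sgn * finCocycle g.mat h.mat⟩⟩

noncomputable instance : Mul MpReal :=
  ⟨fun g h => ⟨g.mat * h.mat, g.sgn * h.sgn * kubota g.mat h.mat⟩⟩

noncomputable instance : Mul MpAdele :=
  ⟨fun g h => ⟨g.fin * h.fin, g.inf * h.inf,
    g.sgn * h.sgn * (finCocycle g.fin h.fin * kubota g.inf h.inf)⟩⟩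

/-- The product `g_f g_∞` in the metaplectic cover of `SL₂(𝔸)` of an element of the cover of
`SL₂(𝔸_f)` and an element of the cover of `SL₂(ℝ)`. -/
def MpAdele.ofParts (gf : MpFin) (gi : MpReal) : MpAdele :=
  ⟨gf.mat, gi.mat, gf.sgn * gi.sgn⟩

/-- The canonical splitting of the cover over `SL₂(ℚ)`. -/
noncomputable def MpAdele.ofRat (γ : SL2 ℚ) : MpAdele :=
  ⟨ratToFin γ, ratToReal γ, ∏ᶠ v : Place, splitSign v (component v (ratToFin γ))⟩

/-- The canonical splitting of the cover over the upper triangular unipotent matrices. -/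
noncomputable def MpAdele.ofUnipotent (x : FinAdele × ℝ) : MpAdele :=
  ⟨unipotent x.1, unipotent x.2, 1⟩

/-- The inverse image of `SL₂(ℤ̂)` in the cover of `SL₂(𝔸_f)`. -/
def MpFin.integral : Set MpFin := {g | g.mat ∈ integralSL2}

/-- The canonical square root of `c z + d` on the cover of `SL₂(ℝ)`. On the elements `(g, 1)` it is
the square root of `c z + d` for the argument in `[-π, π)`; this is the branch for which it is an
automorphy factor for the above multiplication. -/
noncomputable def jHalf (g : MpReal) (z : UpperHalfPlane) : ℂ :=
  ((g.sgn : ℤ) : ℂ) *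
    starRingEnd ℂ ((starRingEnd ℂ (UpperHalfPlane.denom g.mat z)) ^ (1 / 2 : ℂ))

/-! ### Automorphic forms on the metaplectic cover -/

/-- A cuspidal automorphic form on the metaplectic double cover of `SL₂(𝔸)` that corresponds to a
holomorphic modular form of weight `k / 2`. The sets `{(u, 1) | u ∈ U}`, for small open subgroups
`U` of `SL₂(𝔸_f)`, are the small open subgroups of the cover of `SL₂(𝔸_f)`. -/
structure IsMpCuspForm (k : ℤ) (φ : MpAdele → ℂ) : Prop where
  left_invariant : ∀ (γ : SL2 ℚ) (g : MpAdele), φ (MpAdele.ofRat γ * g) = φ g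
  smooth : ∃ U : Subgroup (SL2 FinAdele), IsOpen (U : Set (SL2 FinAdele)) ∧
    ∀ u ∈ U, ∀ g : MpAdele, φ (g * MpAdele.ofParts ⟨u, 1⟩ ⟨1, 1⟩) = φ g
  holomorphic : ∀ gf : MpFin, ∃ f : UpperHalfPlane → ℂ,
    MDifferentiable (modelWithCornersSelf ℂ ℂ) (modelWithCornersSelf ℂ ℂ) f ∧
    UpperHalfPlane.IsBoundedAtImInfty f ∧
    ∀ gi : MpReal, φ (MpAdele.ofParts gf gi) =
      jHalf gi UpperHalfPlane.I ^ (-k) * f (gi.mat • UpperHalfPlane.I)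
  cuspidal : ∀ g : MpAdele, IntegralVanishes fun x => φ (MpAdele.ofUnipotent x * g)

/-- The function `j_{1/2}(g, i)^{-k} e^{2 π i d (g · i)}` on the cover of `SL₂(ℝ)`. -/
noncomputable def mpWhittaker (k : ℤ) (d : ℚ) (g : MpReal) : ℂ :=
  jHalf g UpperHalfPlane.I ^ (-k) *
    Complex.exp (2 * Real.pi * Complex.I * d * ((g.mat • UpperHalfPlane.I : UpperHalfPlane) : ℂ))

/-- `φ(g_f g_∞) = ∑_{d > 0} b_d(g_f) W_{k/2, d}(g_∞)`. The `b_d(g_f)` are determined by `φ`. -/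
def HasMpFourierExpansion (k : ℤ) (φ : MpAdele → ℂ) (b : ℚ → MpFin → ℂ) : Prop :=
  ∀ (gf : MpFin) (gi : MpReal),
    HasSum (fun d : {d : ℚ // 0 < d} => b d gf * mpWhittaker k d gi) (φ (MpAdele.ofParts gf gi))

/-! ### Automorphic forms on `SL₂(𝔸)` -/

/-- A cuspidal automorphic form on `SL₂(𝔸)` that corresponds to a holomorphic modular form of
weight `ℓ`. -/
structure IsCuspForm (ℓ : ℤ) (φ : SL2 FinAdele × SL2 ℝ → ℂ) : Prop where
  left_invariant : ∀ (γ : SL2 ℚ) (g : SL2 FinAdele × SL2 ℝ),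
    φ ((ratToFin γ, ratToReal γ) * g) = φ g
  smooth : ∃ U : Subgroup (SL2 FinAdele), IsOpen (U : Set (SL2 FinAdele)) ∧
    ∀ u ∈ U, ∀ g : SL2 FinAdele × SL2 ℝ, φ (g * (u, 1)) = φ g
  holomorphic : ∀ gf : SL2 FinAdele, ∃ f : UpperHalfPlane → ℂ,
    MDifferentiable (modelWithCornersSelf ℂ ℂ) (modelWithCornersSelf ℂ ℂ) f ∧
    UpperHalfPlane.IsBoundedAtImInfty f ∧
    ∀ gi : SL2 ℝ, φ (gf, gi) =
      UpperHalfPlane.denom gi UpperHalfPlane.I ^ (-ℓ) * f (gi • UpperHalfPlane.I)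
  cuspidal : ∀ g : SL2 FinAdele × SL2 ℝ,
    IntegralVanishes fun x => φ ((unipotent x.1, unipotent x.2) * g)

/-- The function `(c i + d)^{-ℓ} e^{2 π i n (g · i)}` on `SL₂(ℝ)`. -/
noncomputable def whittaker (ℓ : ℤ) (n : ℚ) (g : SL2 ℝ) : ℂ :=
  UpperHalfPlane.denom g UpperHalfPlane.I ^ (-ℓ) *
    Complex.exp (2 * Real.pi * Complex.I * n * ((g • UpperHalfPlane.I : UpperHalfPlane) : ℂ))

/-- `φ(g_f g_∞) = ∑_{d > 0} b_d(g_f) W_{ℓ, d}(g_∞)`. The `b_d(g_f)` are determined by `φ`. -/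
def HasFourierExpansion (ℓ : ℤ) (φ : SL2 FinAdele × SL2 ℝ → ℂ) (b : ℚ → SL2 FinAdele → ℂ) :
    Prop :=
  ∀ (gf : SL2 FinAdele) (gi : SL2 ℝ),
    HasSum (fun d : {d : ℚ // 0 < d} => b d gf * whittaker ℓ d gi) (φ (gf, gi))

/-! ### Normalized coefficients -/

/-- The normalized Fourier coefficient `β_d = d^{-ℓ'/2} b_d`, where `ℓ'` is the weight. -/
noncomputable def normalized {G : Type} (weight : ℝ) (b : ℚ → G → ℂ) (d : ℚ) (g : G) : ℂ :=
  (((d : ℝ) ^ (-weight / 2) : ℝ) : ℂ) * b d g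

/-- For `κ` in `K`, the coefficient `b_d(κ)` is nonzero only if `d ∈ M⁻¹ ℤ`. -/
def SupportedIn {G : Type} (K : Set G) (b : ℚ → G → ℂ) (M : ℕ) : Prop :=
  ∀ κ ∈ K, ∀ d : ℚ, 0 < d → b d κ ≠ 0 → ∃ n : ℤ, d = n / M

end SturmSL2

/-!
The proof compares an automorphic form `φ` with its Fourier coefficients in both directions, by way
of the function `y ^ (w / 2) * |f|`, where `w` is the weight and `f` the function on the upper half
plane attached to `φ` and to an element of the finite part of the group; this function is `|φ|`.

Let `S` be its supremum. A coefficient of an absolutely convergent Fourier series with rational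
frequencies is at most the supremum of the sum (`norm_coeff_le`, by averaging over a period of a
partial sum). So `|β_d| t ^ (w / 2) e ^ (-2πt) ≤ S` for all `t > 0` (`norm_normalized_mul_le`): the
`β_d` are bounded by `e ^ (2π) S`, and they vanish if `w < 0`.

Conversely, by strong approximation and reduction theory, `|φ|` attains all its values at points
`(κ, z)` with `κ` in `K` and `Im z ≥ √3 / 2` (`exists_rat_smul_mem_siegel`), where the Fourier
expansion runs over `d` in `M⁻¹ ℤ`. There the terms with `d < log M / π + A` contribute at most a
constant times `ε M`. In the others `|β_d|` is at most `e ^ (2π) S`, and as `2 y ≥ √3 > 1` the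
factor `e ^ (-2πdy)`, already at most `1 / M` at `d = log M / π`, outweighs the number `M` of
frequencies per unit length; if `A` is large, these terms contribute at most `S / 2`
(`rpow_im_mul_norm_le_of_initial_bound`). Hence `S ≤ const * ε M + S / 2`, which bounds `S`, and with
it all the `β_d`, by a constant times `ε M`.

For the last step `S` has to be finite. Over a single `κ` the form decays at the cusp, since its
frequencies are at least `1 / M` (`exists_rpow_im_mul_norm_le`), and finitely many `κ` suffice because
`SL₂(ℤ̂)` is compact and `φ` is invariant under an open subgroup
(`exists_finset_integralSL2_cosets`).

Strong approximation follows from the density of `ℚ` in the finite adeles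
(`denseRange_rat_finAdele`), because every element of `SL₂(𝔸_f)` is a product of elementary matrices.
On the metaplectic cover the values of the cocycle play no role: `SL₂(ℚ)` and the open subgroup act on
the matrix parts as in the linear group, up to a sign in the cover, and both signs over `SL₂(ℤ̂)`
belong to `K`.
-/

namespace SturmSL2

open Topology Set HeightOneSpectrum

/-! ### Density of `ℚ` in the finite adeles -/

/-- Every neighbourhood of a local integer contains a residue class of integers modulo a power of
the prime. -/
lemma exists_int_add_pow_subset (v : Place) (x : v.adicCompletionIntegers ℚ)
    (U : Set (v.adicCompletionIntegers ℚ)) (hU : U ∈ 𝓝 x) :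
    ∃ (a : ℤ) (n : ℕ), ∀ m : ℤ, m - a ∈ v.asIdeal ^ n →
      algebraMap ℤ (v.adicCompletionIntegers ℚ) m ∈ U := by
  rw [nhds_subtype_eq_comap, Filter.mem_comap] at hU
  obtain ⟨t, ht, htU⟩ := hU
  obtain ⟨γ, hγ⟩ := Valued.mem_nhds.1 ht
  set δ : (WithZero (Multiplicative ℤ))ˣ := Units.map
    (MonoidWithZeroHom.ValueGroup₀.embedding
      (f := .ofClass (Valued.v (R := Completion v)))).toMonoidHom γ with hδ
  have hball : ∀ y : Completion v,
      Valued.v.restrict y < γ.1 ↔ Valued.v y < (δ : WithZero (Multiplicative ℤ)) :=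
    fun y ↦ Valuation.restrict_lt_iff_lt_embedding _
  -- a rational number close to `x` and integral at `v`
  obtain ⟨q, hqx, hq1⟩ : ∃ q : ℚ,
      Valued.v (algebraMap ℚ (Completion v) q - x) < (δ : WithZero (Multiplicative ℤ)) ∧
        v.valuation ℚ q ≤ 1 := by
    have hmem : {y : Completion v | Valued.v.restrict (y - x) < γ.1} ∩
        (v.adicCompletionIntegers ℚ : Set (Completion v)) ∈ 𝓝 (x : Completion v) :=
      Filter.inter_mem (Valued.mem_nhds.2 ⟨γ, subset_rfl⟩)
        ((Valued.isOpen_valuationSubring _).mem_nhds x.2)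
    obtain ⟨q, hq⟩ := (HeightOneSpectrum.denseRange_algebraMap (K := ℚ) v).exists_mem_open
      isOpen_interior ⟨_, mem_interior_iff_mem_nhds.2 hmem⟩
    have hq' := interior_subset hq
    refine ⟨q, (hball _).1 hq'.1, ?_⟩
    exact (valuedAdicCompletion_eq_valuation' v q).symm.trans_le hq'.2
  obtain ⟨a, ha⟩ := v.exists_valuation_sub_lt_of_integer (K := ℚ) hq1 δ
  obtain ⟨n, hn⟩ : ∃ n : ℕ, WithZero.exp (-(n : ℤ)) < (δ : WithZero (Multiplicative ℤ)) := by
    obtain ⟨n, hn, -⟩ := WithZero.exists_exp_neg_natCast_lt_and_lt δ.ne_zero δ.ne_zero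
    exact ⟨n, hn⟩
  refine ⟨a, n, fun m hm ↦ htU (hγ ?_)⟩
  have hma : v.valuation ℚ (algebraMap ℤ ℚ (m - a)) < (δ : WithZero (Multiplicative ℤ)) := by
    rw [valuation_of_algebraMap]
    exact ((v.intValuation_le_pow_iff_mem _ _).2 hm).trans_lt hn
  refine (hball _).2 ?_
  have h1 : Valued.v (algebraMap ℚ (Completion v)
      (algebraMap ℤ ℚ (m - a) + (algebraMap ℤ ℚ a - q))) < (δ : WithZero (Multiplicative ℤ)) :=
    (valuedAdicCompletion_eq_valuation' v _).trans_lt (Valuation.map_add_lt _ hma ha)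
  have h2 := Valuation.map_add_lt _ h1 hqx
  convert h2 using 2
  have h3 : (algebraMap ℤ ℚ (m - a) + (algebraMap ℤ ℚ a - q) : ℚ) = algebraMap ℤ ℚ m - q := by
    rw [map_sub]; ring
  rw [h3]
  have h4 : (algebraMap ℤ (v.adicCompletionIntegers ℚ) m : Completion v) =
      algebraMap ℚ (Completion v) (algebraMap ℤ ℚ m) := rfl
  rw [h4]
  change algebraMap ℚ (Completion v) (algebraMap ℤ ℚ m) - x =
    algebraMap ℚ (Completion v) (algebraMap ℤ ℚ m - q) + (algebraMap ℚ (Completion v) q - x)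
  rw [map_sub]
  ring

/-- `ℤ` is dense in `∏ ℤ_p`. -/
lemma denseRange_int_pi :
    DenseRange (fun (m : ℤ) (v : Place) ↦ algebraMap ℤ (v.adicCompletionIntegers ℚ) m) := by
  classical
  intro x
  rw [mem_closure_iff]
  intro o ho hxo
  obtain ⟨I, u, hu, huo⟩ := isOpen_pi_iff.1 ho x hxo
  have := fun v : I ↦ exists_int_add_pow_subset v (x v) (u v) ((hu v v.2).1.mem_nhds (hu v v.2).2)
  choose a n han using this
  obtain ⟨m, hm⟩ := IsDedekindDomain.exists_forall_sub_mem_ideal (s := I)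
    (fun v : Place ↦ v.asIdeal) (fun v ↦ if h : v ∈ I then n ⟨v, h⟩ else 0)
    (fun v _ ↦ v.prime) (fun v _ w _ hvw h ↦ hvw (HeightOneSpectrum.ext h)) a
  refine ⟨_, huo fun v hv ↦ han ⟨v, hv⟩ m ?_, m, rfl⟩
  have := hm v hv
  rwa [dif_pos (by simpa using hv)] at this

lemma isOpen_adicCompletionIntegers (v : Place) :
    IsOpen (v.adicCompletionIntegers ℚ : Set (Completion v)) :=
  Valued.isOpen_valuationSubring _

/-- The inclusion of `ℤ̂ = ∏ ℤ_p` in `𝔸_f`. -/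
noncomputable def ofIntegers (x : (v : Place) → v.adicCompletionIntegers ℚ) : FinAdele :=
  RestrictedProduct.structureMap (fun v : Place ↦ Completion v)
    (fun v ↦ (v.adicCompletionIntegers ℚ : Set (Completion v))) Filter.cofinite x

lemma isOpenEmbedding_ofIntegers : IsOpenEmbedding ofIntegers :=
  RestrictedProduct.isOpenEmbedding_structureMap isOpen_adicCompletionIntegers

/-- Finite adeles have bounded denominators. -/
lemma exists_int_mul_eq_ofIntegers (x : FinAdele) :
    ∃ (N : ℤ) (y : (v : Place) → v.adicCompletionIntegers ℚ), N ≠ 0 ∧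
      algebraMap ℚ FinAdele N * x = ofIntegers y := by
  have hfin : {v : Place | x v ∉ v.adicCompletionIntegers ℚ}.Finite := x.2
  choose b hb0 hb using fun v : Place ↦
    adicCompletion.mul_nonZeroDivisor_mem_adicCompletionIntegers (K := ℚ) v (x v)
  have key : ∀ v : Place, algebraMap ℚ FinAdele (∏ w ∈ hfin.toFinset, b w : ℤ) v * x v ∈
      v.adicCompletionIntegers ℚ := by
    intro v
    rw [FiniteAdeleRing.algebraMap_apply]
    by_cases hv : x v ∈ v.adicCompletionIntegers ℚ
    · exact mul_mem (coe_mem_adicCompletionIntegers v _) hv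
    · obtain ⟨c, hc⟩ := Finset.dvd_prod_of_mem b (hfin.mem_toFinset.2 hv)
      rw [hc, mul_comm, mul_comm (b v), Int.cast_mul]
      have := mul_mem (coe_mem_adicCompletionIntegers (K := ℚ) v c) (hb v)
      convert this using 1
      change x v * algebraMap ℚ (Completion v) ((c : ℚ) * (b v : ℚ)) = _
      rw [map_mul, mul_left_comm]
      rfl
  refine ⟨∏ w ∈ hfin.toFinset, b w, fun v ↦ ⟨_, key v⟩, ?_, rfl⟩
  exact Finset.prod_ne_zero_iff.2 fun w _ ↦ nonZeroDivisors.ne_zero (hb0 w)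

/-- `ℚ` is dense in the finite adeles. -/
lemma denseRange_rat_finAdele : DenseRange (algebraMap ℚ FinAdele) := by
  intro x
  obtain ⟨N, y, hN, hy⟩ := exists_int_mul_eq_ofIntegers x
  have hx : x = algebraMap ℚ FinAdele (N : ℚ)⁻¹ * ofIntegers y := by
    rw [← hy, ← mul_assoc, ← map_mul, inv_mul_cancel₀ (by exact_mod_cast hN), map_one, one_mul]
  have h1 : ofIntegers y ∈ closure (ofIntegers '' range fun (m : ℤ) (v : Place) ↦
      algebraMap ℤ (v.adicCompletionIntegers ℚ) m) :=
    image_closure_subset_closure_image isOpenEmbedding_ofIntegers.continuous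
      ⟨y, denseRange_int_pi y, rfl⟩
  have hc : Continuous fun z : FinAdele ↦ algebraMap ℚ FinAdele (N : ℚ)⁻¹ * z :=
    continuous_const.mul continuous_id
  rw [hx]
  refine closure_mono ?_ (image_closure_subset_closure_image hc ⟨_, h1, rfl⟩)
  rintro _ ⟨_, ⟨_, ⟨m, rfl⟩, rfl⟩, rfl⟩
  refine ⟨(N : ℚ)⁻¹ * m, ?_⟩
  rw [map_mul]
  rfl

/-! ### Strong approximation and compactness -/

/-- The subgroup `SL₂(ℤ̂)` of `SL₂(𝔸_f)`. -/
def integralSubgroup : Subgroup (SL2 FinAdele) where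
  carrier := integralSL2
  one_mem' v i j := by
    fin_cases i <;> fin_cases j
    · exact one_mem (v.adicCompletionIntegers ℚ)
    · exact zero_mem (v.adicCompletionIntegers ℚ)
    · exact zero_mem (v.adicCompletionIntegers ℚ)
    · exact one_mem (v.adicCompletionIntegers ℚ)
  mul_mem' {g h} hg hh v i j := by
    have : (g * h) i j v = g i 0 v * h 0 j v + g i 1 v * h 1 j v := by
      rw [Matrix.SpecialLinearGroup.coe_mul, Matrix.mul_apply, Fin.sum_univ_two]; rfl
    rw [this]
    exact add_mem (mul_mem (hg v _ _) (hh v _ _)) (mul_mem (hg v _ _) (hh v _ _))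
  inv_mem' {g} hg v i j := by
    rw [Matrix.SpecialLinearGroup.SL2_inv_expl]
    fin_cases i <;> fin_cases j
    · exact hg v 1 1
    · exact neg_mem (hg v 0 1)
    · exact neg_mem (hg v 1 0)
    · exact hg v 0 0

lemma integralSL2_eq_preimage : integralSL2 =
    ((↑) : SL2 FinAdele → Matrix (Fin 2) (Fin 2) FinAdele) ⁻¹'
      {A | ∀ i j, A i j ∈ range ofIntegers} := by
  ext g
  refine ⟨fun h i j ↦ ⟨fun v ↦ ⟨_, h v i j⟩, rfl⟩, fun h v i j ↦ ?_⟩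
  obtain ⟨y, hy⟩ := h i j
  rw [← hy]
  exact (y v).2

lemma isOpen_integralSL2 : IsOpen integralSL2 := by
  rw [integralSL2_eq_preimage]
  refine IsOpen.preimage continuous_subtype_val ?_
  simp only [ofPred_forall]
  refine isOpen_iInter_of_finite fun i ↦ isOpen_iInter_of_finite fun j ↦ ?_
  exact isOpenEmbedding_ofIntegers.isOpen_range.preimage (continuous_id.matrix_elem i j)

lemma compactSpace_adicCompletionIntegers_rat {R : Type*} [CommRing R] [IsDedekindDomain R]
    [Algebra R ℚ] [IsFractionRing R ℚ] [IsIntegralClosure R ℤ ℚ] (v : HeightOneSpectrum R) :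
    CompactSpace (v.adicCompletionIntegers ℚ) :=
  have : Fact (Nat.Prime (Rat.HeightOneSpectrum.primesEquiv v).1) :=
    ⟨(Rat.HeightOneSpectrum.primesEquiv v).2⟩
  (Rat.HeightOneSpectrum.adicCompletionIntegers.padicIntEquiv v).toHomeomorph.symm.compactSpace

instance (v : Place) : CompactSpace (v.adicCompletionIntegers ℚ) :=
  compactSpace_adicCompletionIntegers_rat v

instance : T2Space FinAdele :=
  inferInstanceAs (T2Space (RestrictedProduct (fun v : Place ↦ Completion v)
    (fun v ↦ (v.adicCompletionIntegers ℚ : Set (Completion v))) Filter.cofinite))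

lemma isCompact_integralSL2 : IsCompact integralSL2 := by
  rw [integralSL2_eq_preimage]
  refine (Matrix.SpecialLinearGroup.isClosedEmbedding_val).isCompact_preimage ?_
  have h : IsCompact (range ofIntegers) :=
    isCompact_range isOpenEmbedding_ofIntegers.continuous
  have h2 := isCompact_univ_pi fun _ : Fin 2 ↦ isCompact_univ_pi fun _ : Fin 2 ↦ h
  have heq : (univ.pi fun _ : Fin 2 ↦ univ.pi fun _ : Fin 2 ↦ range ofIntegers) =
      {A | ∀ i j, A i j ∈ range ofIntegers} := by
    ext A
    simp [Set.mem_pi]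
  rw [heq] at h2
  exact h2

/-- For a matrix with lower row `(c, d)` over `𝔸_f`, some `c + x d` is an idele: at every place `c` and
`d` are not both `0`, and at almost all places one of them is a unit. -/
lemma exists_isUnit_add_mul (g : SL2 FinAdele) : ∃ x : FinAdele, IsUnit (g 1 0 + x * g 1 1) := by
  classical
  -- `x = 0` where `|d| ≤ |c|` and `x = 1` elsewhere, so that `|c + x d| = max |c| |d|`
  have hx : ∀ v : Place, (if Valued.v (g 1 1 v) ≤ Valued.v (g 1 0 v) then
      (0 : Completion v) else 1) ∈ v.adicCompletionIntegers ℚ := by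
    intro v
    split_ifs
    · exact zero_mem _
    · exact one_mem _
  have hdet : ∀ v : Place, g 0 0 v * g 1 1 v - g 0 1 v * g 1 0 v = 1 := by
    intro v
    have := congrArg (proj v) (g.det_coe)
    rw [Matrix.det_fin_two, map_sub, map_mul, map_mul, map_one] at this
    exact this
  set x := ofIntegers (fun v ↦ ⟨_, hx v⟩) with hxdef
  have hmax : ∀ v : Place, Valued.v ((g 1 0 + x * g 1 1) v) =
      max (Valued.v (g 1 0 v)) (Valued.v (g 1 1 v)) := by
    intro v
    have h1 : (g 1 0 + x * g 1 1) v = g 1 0 v +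
        (if Valued.v (g 1 1 v) ≤ Valued.v (g 1 0 v) then (0 : Completion v) else 1) * g 1 1 v := rfl
    rw [h1]
    split_ifs with h
    · rw [zero_mul, add_zero, max_eq_left h]
    · rw [one_mul, max_eq_right (not_le.1 h).le]
      exact Valuation.map_add_eq_of_lt_right _ (not_le.1 h)
  refine ⟨x, FiniteAdeleRing.isUnit_iff.2 ⟨fun v h0 ↦ ?_, ?_⟩⟩
  · have h1 := hmax v
    rw [h0, map_zero] at h1
    have hc : g 1 0 v = 0 := by
      rw [← Valuation.zero_iff Valued.v, ← le_zero_iff, h1]; exact le_max_left _ _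
    have hd : g 1 1 v = 0 := by
      rw [← Valuation.zero_iff Valued.v, ← le_zero_iff, h1]; exact le_max_right _ _
    have := hdet v
    rw [hc, hd] at this
    simp at this
  · filter_upwards [(g 0 0).2, (g 0 1).2, (g 1 0).2, (g 1 1).2] with v ha hb hc hd
    rw [hmax v]
    refine le_antisymm (max_le hc hd) (not_lt.1 fun hlt ↦ ?_)
    obtain ⟨hlc, hld⟩ := max_lt_iff.1 hlt
    have h1 : Valued.v (g 0 0 v * g 1 1 v - g 0 1 v * g 1 0 v) < 1 := by
      refine Valuation.map_sub_lt _ ?_ ?_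
      · rw [map_mul]
        exact (mul_le_of_le_one_left' ha).trans_lt hld
      · rw [map_mul]
        exact (mul_le_of_le_one_left' hb).trans_lt hlc
    rw [hdet v, map_one] at h1
    exact lt_irrefl _ h1

/-- The lower triangular unipotent matrix with lower left entry `x`. -/
def lowerUnipotent {R : Type} [CommRing R] (x : R) : SL2 R :=
  ⟨!![1, 0; x, 1], by simp⟩

/-- A matrix in `SL₂` whose lower left entry becomes a unit after a column operation is a product of
four elementary matrices. -/
lemma exists_elementary_factorization {R : Type} [CommRing R] (g : SL2 R) (x : R)
    (h : IsUnit (g 1 0 + x * g 1 1)) :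
    ∃ y z w : R, g = unipotent y * lowerUnipotent z * unipotent w * lowerUnipotent (-x) := by
  obtain ⟨u, hu⟩ := h.exists_left_inv
  have hdet := g.det_coe
  rw [Matrix.det_fin_two] at hdet
  refine ⟨(g 0 0 + x * g 0 1 - 1) * u, g 1 0 + x * g 1 1, u * (g 1 1 - 1), ?_⟩
  refine Subtype.ext ?_
  change (g : Matrix (Fin 2) (Fin 2) R) = !![1, (g 0 0 + x * g 0 1 - 1) * u; 0, 1] *
    !![1, 0; g 1 0 + x * g 1 1, 1] * !![1, u * (g 1 1 - 1); 0, 1] * !![1, 0; -x, 1]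
  refine (Matrix.eta_fin_two _).trans ?_
  generalize g 0 0 = a, g 0 1 = b, g 1 0 = c, g 1 1 = d at hu hdet ⊢
  simp only [Matrix.mul_fin_two]
  ext i j
  fin_cases i <;> fin_cases j <;> simp
  · linear_combination (-(a + x * b - 1) + x * (b + (a + x * b - 1) * (u * (d - 1)))) * hu +
      x * u * hdet
  · linear_combination (-(b + (a + x * b - 1) * (u * (d - 1)))) * hu - u * hdet
  · linear_combination x * (d - 1) * hu
  · linear_combination (-(d - 1)) * hu

lemma ratToFin_unipotent (q : ℚ) :
    ratToFin (unipotent q) = unipotent (algebraMap ℚ FinAdele q) := by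
  refine Subtype.ext (Matrix.ext fun i j ↦ ?_)
  fin_cases i <;> fin_cases j
  · exact map_one (algebraMap ℚ FinAdele)
  · rfl
  · exact map_zero (algebraMap ℚ FinAdele)
  · exact map_one (algebraMap ℚ FinAdele)

lemma ratToFin_lowerUnipotent (q : ℚ) :
    ratToFin (lowerUnipotent q) = lowerUnipotent (algebraMap ℚ FinAdele q) := by
  refine Subtype.ext (Matrix.ext fun i j ↦ ?_)
  fin_cases i <;> fin_cases j
  · exact map_one (algebraMap ℚ FinAdele)
  · exact map_zero (algebraMap ℚ FinAdele)
  · rfl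
  · exact map_one (algebraMap ℚ FinAdele)

lemma continuous_unipotent : Continuous (unipotent : FinAdele → SL2 FinAdele) := by
  refine continuous_induced_rng.2 (continuous_matrix fun i j ↦ ?_)
  fin_cases i <;> fin_cases j
  · exact continuous_const
  · exact continuous_id
  · exact continuous_const
  · exact continuous_const

lemma continuous_lowerUnipotent : Continuous (lowerUnipotent : FinAdele → SL2 FinAdele) := by
  refine continuous_induced_rng.2 (continuous_matrix fun i j ↦ ?_)
  fin_cases i <;> fin_cases j
  · exact continuous_const
  · exact continuous_const
  · exact continuous_id
  · exact continuous_const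

/-- Strong approximation: `SL₂(ℚ)` is dense in `SL₂(𝔸_f)`. Its closure is a subgroup that contains the
elementary matrices. -/
lemma denseRange_ratToFin : DenseRange ratToFin := by
  let φ : SL2 ℚ →* SL2 FinAdele := Matrix.SpecialLinearGroup.map (algebraMap ℚ FinAdele)
  have hφ : (φ.range.topologicalClosure : Set (SL2 FinAdele)) = closure (range ratToFin) := by
    rw [Subgroup.topologicalClosure_coe, MonoidHom.coe_range]
    rfl
  have hu : ∀ x, unipotent x ∈ φ.range.topologicalClosure := by
    intro x
    rw [← SetLike.mem_coe, hφ]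
    refine closure_mono ?_ (image_closure_subset_closure_image continuous_unipotent
      ⟨x, denseRange_rat_finAdele x, rfl⟩)
    rintro _ ⟨_, ⟨q, rfl⟩, rfl⟩
    exact ⟨unipotent q, ratToFin_unipotent q⟩
  have hl : ∀ x, lowerUnipotent x ∈ φ.range.topologicalClosure := by
    intro x
    rw [← SetLike.mem_coe, hφ]
    refine closure_mono ?_ (image_closure_subset_closure_image continuous_lowerUnipotent
      ⟨x, denseRange_rat_finAdele x, rfl⟩)
    rintro _ ⟨_, ⟨q, rfl⟩, rfl⟩
    exact ⟨lowerUnipotent q, ratToFin_lowerUnipotent q⟩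
  intro g
  obtain ⟨x, hx⟩ := exists_isUnit_add_mul g
  obtain ⟨y, z, w, hg⟩ := exists_elementary_factorization g x hx
  rw [← hφ, hg]
  exact mul_mem (mul_mem (mul_mem (hu _) (hl _)) (hu _)) (hl _)

/-- `SL₂(𝔸_f) = SL₂(ℚ) SL₂(ℤ̂)`. -/
lemma exists_ratToFin_mul_mem_integralSL2 (g : SL2 FinAdele) :
    ∃ γ : SL2 ℚ, ratToFin γ * g ∈ integralSL2 := by
  have hopen : IsOpen {h : SL2 FinAdele | h * g ∈ integralSL2} :=
    isOpen_integralSL2.preimage (continuous_mul_const g)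
  obtain ⟨γ, hγ⟩ := denseRange_ratToFin.exists_mem_open hopen
    ⟨g⁻¹, by rw [mem_ofPred_eq, inv_mul_cancel]; exact integralSubgroup.one_mem⟩
  exact ⟨γ, hγ⟩

/-- An open subgroup of `SL₂(𝔸_f)` has finitely many cosets in `SL₂(ℤ̂)`. -/
lemma exists_finset_integralSL2_cosets (U : Subgroup (SL2 FinAdele))
    (hU : IsOpen (U : Set (SL2 FinAdele))) :
    ∃ F : Finset (SL2 FinAdele), ∀ κ ∈ integralSL2, ∃ κ' ∈ F, κ' ∈ integralSL2 ∧
      ∃ u ∈ U, κ = κ' * u := by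
  obtain ⟨F, hF, hcover⟩ := isCompact_integralSL2.elim_nhds_subcover
    (fun g ↦ {h | g⁻¹ * h ∈ U}) fun g _ ↦
      (hU.preimage (continuous_const_mul g⁻¹)).mem_nhds (by simp)
  refine ⟨F, fun κ hκ ↦ ?_⟩
  obtain ⟨g, hg, hgU⟩ := mem_iUnion₂.1 (hcover hκ)
  exact ⟨g, hg, hF g hg, g⁻¹ * κ, hgU, by group⟩

/-! ### Reduction theory -/

/-- The group `SL₂(𝔸)` is covered by the `SL₂(ℚ)`-translates of the product of `SL₂(ℤ̂)` and a Siegel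
domain. The number `4 / 5` is a rational lower bound of `√3 / 2`, large enough for
`rpow_im_mul_norm_le_of_initial_bound`. -/
lemma exists_rat_smul_mem_siegel (g : SL2 FinAdele) (h : SL2 ℝ) :
    ∃ γ : SL2 ℚ, ratToFin γ * g ∈ integralSL2 ∧
      4 / 5 ≤ ((ratToReal γ * h) • UpperHalfPlane.I : UpperHalfPlane).im := by
  obtain ⟨γ₁, h₁⟩ := exists_ratToFin_mul_mem_integralSL2 g
  obtain ⟨γ₂, h₂⟩ := ModularGroup.exists_smul_mem_fd
    ((ratToReal γ₁ * h) • UpperHalfPlane.I : UpperHalfPlane)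
  have h₃ := ModularGroup.three_le_four_mul_im_sq_of_mem_fd h₂
  -- `SL₂(ℤ)` preserves `SL₂(ℤ̂)`
  refine ⟨Matrix.SpecialLinearGroup.map (Int.castRingHom ℚ) γ₂ * γ₁, ?_, ?_⟩
  · have : ratToFin (Matrix.SpecialLinearGroup.map (Int.castRingHom ℚ) γ₂) ∈ integralSL2 :=
      fun v i j ↦ coe_mem_adicCompletionIntegers v (γ₂ i j)
    have h := integralSubgroup.mul_mem this h₁
    rwa [← mul_assoc, ratToFin, ratToFin, ← map_mul] at h
  · have heq : ratToReal (Matrix.SpecialLinearGroup.map (Int.castRingHom ℚ) γ₂ * γ₁) * h =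
        (Matrix.SpecialLinearGroup.map (Int.castRingHom ℝ) γ₂) * (ratToReal γ₁ * h) := by
      rw [ratToReal, ratToReal, map_mul, mul_assoc]
      congr 1
    rw [heq, mul_smul]
    have h₄ : (Matrix.SpecialLinearGroup.map (Int.castRingHom ℝ) γ₂) •
        ((ratToReal γ₁ * h) • UpperHalfPlane.I : UpperHalfPlane) =
        γ₂ • ((ratToReal γ₁ * h) • UpperHalfPlane.I : UpperHalfPlane) := rfl
    rw [h₄]
    have := (γ₂ • ((ratToReal γ₁ * h) • UpperHalfPlane.I : UpperHalfPlane)).im_pos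
    nlinarith

end SturmSL2

namespace SturmSL2

/-! ### Fourier series with rational frequencies -/

open Complex in
/-- A nontrivial exponential has integral zero over a period. -/
lemma integral_exp_int_period {q : ℚ} (hq : q ≠ 0) {N : ℕ} {m : ℤ} (hm : q * N = m) :
    ∫ x in (0 : ℝ)..N, cexp (2 * Real.pi * I * q * x) = 0 := by
  have hc : (2 * Real.pi * I * q : ℂ) ≠ 0 := by
    simp [Real.pi_ne_zero, hq]
  rw [integral_exp_mul_complex hc]
  have h1 : (2 * Real.pi * I * q : ℂ) * ((N : ℝ) : ℂ) = m * (2 * Real.pi * I) := by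
    have : (q : ℂ) * N = m := by exact_mod_cast hm
    push_cast
    linear_combination (2 * Real.pi * I : ℂ) * this
  rw [h1, exp_int_mul_two_pi_mul_I]
  simp

open Complex in
/-- A coefficient of a finite trigonometric sum with rational frequencies is bounded by the supremum
of the sum. -/
lemma norm_coeff_le_of_finset (s : Finset {d : ℚ // 0 < d}) (c : {d : ℚ // 0 < d} → ℂ) {S : ℝ}
    (hS : ∀ x : ℝ, ‖∑ d ∈ s, c d * cexp (2 * Real.pi * I * (d : ℚ) * x)‖ ≤ S)
    {d₀ : {d : ℚ // 0 < d}} (hd₀ : d₀ ∈ s) : ‖c d₀‖ ≤ S := by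
  classical
  -- a common period of all the exponentials
  set N : ℕ := ∏ d ∈ s, (d : ℚ).den with hN
  have hN0 : 0 < N := Finset.prod_pos fun d _ ↦ (d : ℚ).den_pos
  have hint : ∀ d ∈ s, ∃ m : ℤ, (d : ℚ) * N = m := by
    intro d hd
    obtain ⟨e, he⟩ := Finset.dvd_prod_of_mem (fun d : {d : ℚ // 0 < d} ↦ (d : ℚ).den) hd
    refine ⟨(d : ℚ).num * e, ?_⟩
    rw [hN, he]
    push_cast
    rw [← mul_assoc, Rat.mul_den_eq_num]
  have hval : ∫ x in (0 : ℝ)..N, (∑ d ∈ s, c d * cexp (2 * Real.pi * I * (d : ℚ) * x)) *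
      cexp (-(2 * Real.pi * I * (d₀ : ℚ) * x)) = N * c d₀ := by
    have h1 : ∀ x : ℝ, (∑ d ∈ s, c d * cexp (2 * Real.pi * I * (d : ℚ) * x)) *
        cexp (-(2 * Real.pi * I * (d₀ : ℚ) * x)) =
        ∑ d ∈ s, c d * cexp (2 * Real.pi * I * ((d - d₀ : ℚ) : ℂ) * x) := by
      intro x
      rw [Finset.sum_mul]
      refine Finset.sum_congr rfl fun d _ ↦ ?_
      rw [mul_assoc, ← Complex.exp_add]
      congr 2
      push_cast
      ring
    simp_rw [h1]
    rw [intervalIntegral.integral_finsetSum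
      fun d _ ↦ (Continuous.intervalIntegrable (by fun_prop) _ _)]
    rw [Finset.sum_eq_single_of_mem d₀ hd₀]
    · simp
    · intro d hd hne
      obtain ⟨m, hm⟩ := hint d hd
      obtain ⟨m₀, hm₀⟩ := hint d₀ hd₀
      rw [intervalIntegral.integral_const_mul,
        integral_exp_int_period (N := N) (m := m - m₀) (sub_ne_zero.2 fun h ↦ hne (Subtype.ext h)),
        mul_zero]
      push_cast
      rw [sub_mul, hm, hm₀]
  have hle := intervalIntegral.norm_integral_le_of_norm_le_const (a := 0) (b := N) (C := S)
    (f := fun x : ℝ ↦ (∑ d ∈ s, c d * cexp (2 * Real.pi * I * (d : ℚ) * x)) *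
      cexp (-(2 * Real.pi * I * (d₀ : ℚ) * x))) fun x _ ↦ by
    rw [norm_mul, Complex.norm_exp]
    simpa using hS x
  rw [hval, norm_mul, sub_zero, Complex.norm_natCast, abs_of_nonneg (by positivity),
    mul_comm] at hle
  exact le_of_mul_le_mul_right hle (by exact_mod_cast hN0)

open Complex in
/-- A coefficient of an absolutely convergent Fourier series with rational frequencies is bounded by
the supremum of the sum. -/
lemma norm_coeff_le (c : {d : ℚ // 0 < d} → ℂ) (F : ℝ → ℂ) {S : ℝ}
    (hF : ∀ x : ℝ, HasSum (fun d ↦ c d * cexp (2 * Real.pi * I * (d : ℚ) * x)) (F x))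
    (hS : ∀ x : ℝ, ‖F x‖ ≤ S) (d₀ : {d : ℚ // 0 < d}) : ‖c d₀‖ ≤ S := by
  classical
  have hsum : Summable fun d ↦ ‖c d‖ := by
    have := (hF 0).summable.norm
    simpa using this
  refine le_of_forall_pos_le_add fun η hη ↦ ?_
  obtain ⟨s, hs⟩ := (summable_iff_vanishing_norm.1 hsum) η hη
  refine norm_coeff_le_of_finset (insert d₀ s) c (fun x ↦ ?_) (Finset.mem_insert_self d₀ s)
  -- compare the partial sum with larger partial sums, which converge to `F x`
  have hlim : Filter.Tendsto (fun t : Finset {d : ℚ // 0 < d} ↦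
      ‖∑ d ∈ t, c d * cexp (2 * Real.pi * I * (d : ℚ) * x)‖ + η) Filter.atTop
      (nhds (‖F x‖ + η)) := (Filter.Tendsto.norm (hF x)).add_const η
  refine (ge_of_tendsto hlim ?_).trans (add_le_add_left (hS x) η)
  filter_upwards [Filter.eventually_ge_atTop (insert d₀ s)] with t ht
  rw [← Finset.sum_sdiff ht]
  have h2 := hs (t \ insert d₀ s) (Finset.disjoint_left.2 fun d hd hd' ↦
    (Finset.mem_sdiff.1 hd).2 (Finset.mem_insert_of_mem hd'))
  have h3 : ‖∑ d ∈ t \ insert d₀ s, c d * cexp (2 * Real.pi * I * (d : ℚ) * x)‖ ≤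
      ‖∑ d ∈ t \ insert d₀ s, ‖c d‖‖ := by
    rw [Real.norm_of_nonneg (Finset.sum_nonneg fun _ _ ↦ norm_nonneg _)]
    refine norm_sum_le_of_le _ fun d _ ↦ ?_
    rw [norm_mul, Complex.norm_exp]
    simp
  have h4 := norm_sub_le (∑ d ∈ t \ insert d₀ s, c d * cexp (2 * Real.pi * I * (d : ℚ) * x) +
    ∑ d ∈ insert d₀ s, c d * cexp (2 * Real.pi * I * (d : ℚ) * x))
    (∑ d ∈ t \ insert d₀ s, c d * cexp (2 * Real.pi * I * (d : ℚ) * x))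
  rw [add_sub_cancel_left] at h4
  linarith

/-! ### Elementary estimates -/

lemma rpow_le_const_mul_exp {a δ t : ℝ} (ha : 0 ≤ a) (hδ : 0 < δ) (ht : 0 ≤ t) :
    t ^ a ≤ (a / δ) ^ a * Real.exp (δ * t) := by
  rcases ha.eq_or_lt with rfl | ha
  · simpa using mul_nonneg hδ.le ht
  · have h1 : δ * t / a ≤ Real.exp (δ * t / a) := by
      linarith [Real.add_one_le_exp (δ * t / a)]
    have h2 : t ≤ a / δ * Real.exp (δ * t / a) := by
      calc t = a / δ * (δ * t / a) := by field_simp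
        _ ≤ _ := by gcongr
    calc t ^ a ≤ (a / δ * Real.exp (δ * t / a)) ^ a := by gcongr
      _ = _ := by
        rw [Real.mul_rpow (by positivity) (by positivity), ← Real.exp_mul, div_mul_cancel₀ _ ha.ne']

/-- A power of `y` is dominated by any growing exponential on `[4/5, ∞)`. -/
lemma exists_rpow_le_const_mul_exp (a : ℝ) {δ : ℝ} (hδ : 0 < δ) :
    ∃ C : ℝ, 0 ≤ C ∧ ∀ y : ℝ, 4 / 5 ≤ y → y ^ a ≤ C * Real.exp (δ * y) := by
  rcases le_total 0 a with ha | ha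
  · exact ⟨(a / δ) ^ a, by positivity, fun y hy ↦ rpow_le_const_mul_exp ha hδ (by linarith)⟩
  · refine ⟨(4 / 5 : ℝ) ^ a, by positivity, fun y hy ↦ ?_⟩
    refine (Real.rpow_le_rpow_of_nonpos (by norm_num) hy ha).trans ?_
    refine le_mul_of_one_le_right (by positivity) (Real.one_le_exp ?_)
    exact mul_nonneg hδ.le (by linarith)

/-- The geometric series of `e ^ (-r)`, compared with the integral of `e ^ (-r x)`. -/
lemma exists_hasSum_exp_neg_le {r : ℝ} (hr : 0 < r) :
    ∃ s : ℝ, HasSum (fun n : ℕ ↦ Real.exp (-((n + 1) * r))) s ∧ s ≤ 1 / r := by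
  have hq : Real.exp (-r) < 1 := by
    rw [← Real.exp_zero]; exact Real.exp_lt_exp.2 (by linarith)
  refine ⟨Real.exp (-r) * (1 - Real.exp (-r))⁻¹, ?_, ?_⟩
  · have heq : (fun n : ℕ ↦ Real.exp (-((n + 1) * r))) =
        fun n : ℕ ↦ Real.exp (-r) * Real.exp (-r) ^ n := by
      funext n
      rw [← Real.exp_nat_mul, ← Real.exp_add]
      congr 1
      ring
    rw [heq]
    exact (hasSum_geometric_of_lt_one (Real.exp_pos (-r)).le hq).mul_left (Real.exp (-r))
  · rw [← div_eq_mul_inv, div_le_div_iff₀ (by linarith) hr]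
    have h1 : Real.exp (-r) * (r + 1) ≤ 1 := by
      calc Real.exp (-r) * (r + 1) ≤ Real.exp (-r) * Real.exp r := by
            gcongr; exact Real.add_one_le_exp r
        _ = 1 := by rw [← Real.exp_add]; simp
    linarith

end SturmSL2

namespace SturmSL2

open UpperHalfPlane

/-! ### The Sturm bound for families of Fourier series -/

lemma norm_normalized {G : Type} (w : ℝ) (b : ℚ → G → ℂ) {d : ℚ} (hd : 0 < d) (g : G) :
    ‖normalized w b d g‖ = (d : ℝ) ^ (-w / 2) * ‖b d g‖ := by
  have : (0 : ℝ) < d := by exact_mod_cast hd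
  rw [normalized, norm_mul, Complex.norm_real, Real.norm_of_nonneg (by positivity)]

lemma norm_eq_rpow_mul_norm_normalized {G : Type} (w : ℝ) (b : ℚ → G → ℂ) {d : ℚ} (hd : 0 < d)
    (g : G) : ‖b d g‖ = (d : ℝ) ^ (w / 2) * ‖normalized w b d g‖ := by
  have : (0 : ℝ) < d := by exact_mod_cast hd
  rw [norm_normalized w b hd, ← mul_assoc, ← Real.rpow_add this, neg_div, add_neg_cancel,
    Real.rpow_zero, one_mul]

lemma norm_exp_two_pi_I_mul (d : ℚ) (z : ℂ) :
    ‖Complex.exp (2 * Real.pi * Complex.I * d * z)‖ = Real.exp (-(2 * Real.pi * d * z.im)) := by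
  rw [Complex.norm_exp]
  congr 1
  have : (2 * Real.pi * Complex.I * d * z : ℂ) = ((2 * Real.pi * d : ℝ) : ℂ) * (Complex.I * z) := by
    push_cast; ring
  rw [this, Complex.re_ofReal_mul, Complex.I_mul_re]
  ring

variable {X : Type} {b : ℚ → X → ℂ} {g : X} {f : ℍ → ℂ} {w : ℝ}

/-- The normalized coefficients of `f` are bounded in terms of the supremum of
`y ^ (w / 2) * |f|`. This is the bound for the coefficient of `f` on the line `y = t / d`. -/
lemma norm_normalized_mul_le
    (hf : ∀ z : ℍ, HasSum (fun d : {d : ℚ // 0 < d} ↦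
      b d g * Complex.exp (2 * Real.pi * Complex.I * (d : ℚ) * z)) (f z))
    {S : ℝ} (hS : ∀ z : ℍ, z.im ^ (w / 2) * ‖f z‖ ≤ S) {d : ℚ} (hd : 0 < d) {t : ℝ} (ht : 0 < t) :
    ‖normalized w b d g‖ * (t ^ (w / 2) * Real.exp (-(2 * Real.pi * t))) ≤ S := by
  have hd' : (0 : ℝ) < d := by exact_mod_cast hd
  set y : ℝ := t / d with hy
  have hy0 : 0 < y := by positivity
  let z : ℝ → ℍ := fun x ↦ ⟨⟨x, y⟩, hy0⟩
  have hz : ∀ x, ((z x : ℍ) : ℂ) = x + y * Complex.I := fun x ↦ Complex.mk_eq_add_mul_I x y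
  have hle := norm_coeff_le
    (fun d : {d : ℚ // 0 < d} ↦ b d g * Complex.exp (-(2 * Real.pi * (d : ℚ) * y : ℂ)))
    (fun x ↦ f (z x)) (S := S / y ^ (w / 2)) (fun x ↦ ?_) (fun x ↦ ?_) ⟨d, hd⟩
  · have he : ‖Complex.exp (-(2 * Real.pi * d * y : ℂ))‖ = Real.exp (-(2 * Real.pi * t)) := by
      have : (-(2 * Real.pi * d * y : ℂ)) = ((-(2 * Real.pi * t) : ℝ) : ℂ) := by
        have h1 : (d : ℝ) * y = t := by rw [hy]; field_simp
        rw [← h1]; push_cast; ring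
      rw [this, Complex.norm_exp, Complex.ofReal_re]
    rw [norm_mul, he, le_div_iff₀ (by positivity), norm_eq_rpow_mul_norm_normalized w b hd g] at hle
    have h2 : t ^ (w / 2) = d ^ (w / 2) * y ^ (w / 2) := by
      rw [← Real.mul_rpow hd'.le hy0.le, hy]; congr 1; field_simp
    rw [h2]
    linarith
  · convert hf (z x) using 2 with e
    rw [mul_assoc, ← Complex.exp_add, hz]
    congr 2
    ring_nf
    rw [Complex.I_sq]
    ring
  · rw [le_div_iff₀ (by positivity), mul_comm]
    exact hS (z x)

/-- A uniform bound for the terms of the Fourier expansion of a form with frequencies in `M⁻¹ ℤ`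
gives a bound for the form. -/
lemma rpow_im_mul_norm_le {κ : X} {z : ℍ}
    (hf : HasSum (fun d : {d : ℚ // 0 < d} ↦
      b d κ * Complex.exp (2 * Real.pi * Complex.I * (d : ℚ) * z)) (f z))
    {M : ℕ} (hM : 1 ≤ M) (hsupp : ∀ d : ℚ, 0 < d → b d κ ≠ 0 → ∃ n : ℤ, d = n / M)
    {E : ℝ} (hE : 0 ≤ E)
    (hb : ∀ d : ℚ, 0 < d → ‖normalized w b d κ‖ * ((d * z.im) ^ (w / 2) *
      Real.exp (-(2 * Real.pi * (d * z.im)))) ≤ E * Real.exp (-(d * z.im))) :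
    z.im ^ (w / 2) * ‖f z‖ ≤ E * (M / z.im) := by
  have hy := z.im_pos
  have hM0 : (0 : ℚ) < M := by exact_mod_cast hM
  have hM0' : (0 : ℝ) < M := by exact_mod_cast hM
  -- the frequencies in `M⁻¹ ℤ`
  let ι : ℕ → {d : ℚ // 0 < d} := fun n ↦ ⟨(n + 1) / M, by positivity⟩
  have hι : Function.Injective ι := by
    intro m n h
    have h1 : ((m : ℚ) + 1) / M = (n + 1) / M := congrArg Subtype.val h
    have h2 := (div_left_inj' hM0.ne').1 h1
    exact_mod_cast add_right_cancel h2
  have hf' := (hι.hasSum_iff (f := fun d : {d : ℚ // 0 < d} ↦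
      b d κ * Complex.exp (2 * Real.pi * Complex.I * (d : ℚ) * z)) (a := f z) ?_).2 hf
  · obtain ⟨s, hs, hsle⟩ := exists_hasSum_exp_neg_le (r := z.im / M) (by positivity)
    have hy' : (0 : ℝ) < z.im ^ (w / 2) := by positivity
    have hle : ‖f z‖ ≤ E / z.im ^ (w / 2) * s := by
      refine hf'.norm_le_of_bounded (hs.mul_left _) fun n ↦ ?_
      have hd : 0 < ((ι n : {d : ℚ // 0 < d}) : ℚ) := (ι n).2
      have hd' : (0 : ℝ) < ((ι n : {d : ℚ // 0 < d}) : ℚ) := by exact_mod_cast hd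
      have h1 := hb _ hd
      have h2 : (((ι n : {d : ℚ // 0 < d}) : ℚ) : ℝ) * z.im = (n + 1) * (z.im / M) := by
        simp only [ι]
        push_cast
        ring
      rw [← h2]
      simp only [Function.comp_apply]
      rw [norm_mul, norm_exp_two_pi_I_mul, norm_eq_rpow_mul_norm_normalized w b hd,
        div_mul_eq_mul_div, le_div_iff₀ hy']
      rw [Real.mul_rpow hd'.le hy.le] at h1
      have h3 : ((z : ℂ)).im = z.im := rfl
      rw [h3, mul_assoc (2 * Real.pi)]
      linarith
    calc z.im ^ (w / 2) * ‖f z‖ ≤ z.im ^ (w / 2) * (E / z.im ^ (w / 2) * s) := by gcongr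
      _ = E * s := by field_simp
      _ ≤ E * (1 / (z.im / M)) := by gcongr
      _ = _ := by rw [one_div_div]
  · intro d hd
    have : b d κ = 0 := by
      by_contra h0
      obtain ⟨n, hn⟩ := hsupp d d.2 h0
      have hn0 : 0 < n := by
        have h1 : (0 : ℚ) < n / M := hn ▸ d.2
        have h2 : (0 : ℚ) < n := (div_pos_iff_of_pos_right hM0).1 h1
        exact_mod_cast h2
      refine hd ⟨(n - 1).toNat, Subtype.ext ?_⟩
      have h3 : ((n - 1).toNat : ℚ) = n - 1 := by
        have : (((n - 1).toNat : ℤ) : ℚ) = ((n - 1 : ℤ) : ℚ) := by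
          rw [Int.toNat_of_nonneg (by omega)]
        push_cast at this
        exact_mod_cast this
      simp only [ι]
      rw [h3, sub_add_cancel, hn]
    rw [this, zero_mul]

/-- A form with frequencies in `M⁻¹ ℤ` is bounded near the cusp. -/
lemma exists_rpow_im_mul_norm_le (w : ℝ) {κ : X}
    (hf : ∀ z : ℍ, HasSum (fun d : {d : ℚ // 0 < d} ↦
      b d κ * Complex.exp (2 * Real.pi * Complex.I * (d : ℚ) * z)) (f z))
    {M : ℕ} (hM : 1 ≤ M) (hsupp : ∀ d : ℚ, 0 < d → b d κ ≠ 0 → ∃ n : ℤ, d = n / M) :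
    ∃ S : ℝ, ∀ z : ℍ, 4 / 5 ≤ z.im → z.im ^ (w / 2) * ‖f z‖ ≤ S := by
  have hM0 : (0 : ℚ) < M := by exact_mod_cast hM
  have hM0' : (0 : ℝ) < M := by exact_mod_cast hM
  let z₀ : ℍ := ⟨⟨0, 4 / 5⟩, by norm_num⟩
  have hsum := (hf z₀).summable.norm.hasSum
  set C₀ := ∑' d : {d : ℚ // 0 < d},
    ‖b d κ * Complex.exp (2 * Real.pi * Complex.I * (d : ℚ) * z₀)‖
  set δ : ℝ := 2 * Real.pi / M with hδ
  have hδ0 : 0 < δ := by positivity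
  obtain ⟨C, hC0, hC⟩ := exists_rpow_le_const_mul_exp (w / 2) hδ0
  refine ⟨C * (C₀ * Real.exp (δ * (4 / 5))), fun z hz ↦ ?_⟩
  have hle : ‖f z‖ ≤ C₀ * Real.exp (-(δ * (z.im - 4 / 5))) := by
    refine (hf z).norm_le_of_bounded (hsum.mul_right _) fun d ↦ ?_
    rw [norm_mul, norm_mul, norm_exp_two_pi_I_mul, norm_exp_two_pi_I_mul, mul_assoc ‖b d κ‖,
      ← Real.exp_add]
    by_cases h0 : b d κ = 0
    · simp [h0]
    · gcongr
      -- a frequency that occurs is at least `1 / M`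
      have hd : 1 / (M : ℝ) ≤ ((d : ℚ) : ℝ) := by
        obtain ⟨n, hn⟩ := hsupp d d.2 h0
        have h2 : (0 : ℚ) < n := (div_pos_iff_of_pos_right hM0).1 (hn ▸ d.2)
        have h3 : (1 : ℤ) ≤ n := by
          have : (0 : ℤ) < n := by exact_mod_cast h2
          omega
        rw [hn]
        push_cast
        gcongr
        exact_mod_cast h3
      have h1 : ((z₀ : ℍ) : ℂ).im = 4 / 5 := rfl
      have h2 : ((z : ℍ) : ℂ).im = z.im := rfl
      rw [h1, h2, hδ]
      have h3 : 2 * Real.pi * (1 / M) * (z.im - 4 / 5) ≤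
          2 * Real.pi * (d : ℚ) * (z.im - 4 / 5) := by
        have := Real.pi_pos
        have : 0 ≤ z.im - 4 / 5 := by linarith
        gcongr
      have h4 : 2 * Real.pi / M * (z.im - 4 / 5) = 2 * Real.pi * (1 / M) * (z.im - 4 / 5) := by ring
      linarith
  calc z.im ^ (w / 2) * ‖f z‖
      ≤ (C * Real.exp (δ * z.im)) * (C₀ * Real.exp (-(δ * (z.im - 4 / 5)))) := by
        gcongr
        exact hC _ hz
    _ = C * (C₀ * (Real.exp (δ * z.im) * Real.exp (-(δ * (z.im - 4 / 5))))) := by ring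
    _ = _ := by
      rw [← Real.exp_add]
      congr 4
      ring

end SturmSL2

namespace SturmSL2

open UpperHalfPlane

/-- A form of negative weight with a bounded `y ^ (w / 2) * |f|` vanishes, as `y ^ (w / 2)` tends to
infinity for `y → 0`. -/
lemma normalized_eq_zero_of_neg {X : Type} {b : ℚ → X → ℂ} {g : X} {f : ℍ → ℂ} {w : ℝ} 
    (hw : w < 0) (hf : ∀ z : ℍ, HasSum (fun d : {d : ℚ // 0 < d} ↦
      b d g * Complex.exp (2 * Real.pi * Complex.I * (d : ℚ) * z)) (f z))
    {S : ℝ} (hS : ∀ z : ℍ, z.im ^ (w / 2) * ‖f z‖ ≤ S) {d : ℚ} (hd : 0 < d) :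
    normalized w b d g = 0 := by
  by_contra h0
  have hβ : 0 < ‖normalized w b d g‖ := norm_pos_iff.2 h0
  have hS0 : 0 ≤ S := le_trans (by have := UpperHalfPlane.I.im_pos; positivity) (hS UpperHalfPlane.I)
  -- choose `t ≤ 1` with `t ^ (w / 2)` too large
  set R : ℝ := S * Real.exp (2 * Real.pi) / ‖normalized w b d g‖ + 1 with hR
  have hR1 : 1 ≤ R := by
    have : 0 ≤ S * Real.exp (2 * Real.pi) / ‖normalized w b d g‖ := by positivity
    linarith
  have ht0 : 0 < R ^ (w / 2)⁻¹ := by positivity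
  have ht1 : R ^ (w / 2)⁻¹ ≤ 1 := by
    refine Real.rpow_le_one_of_one_le_of_nonpos hR1 ?_
    exact inv_nonpos.2 (by linarith)
  have h := norm_normalized_mul_le hf hS hd ht0
  rw [Real.rpow_inv_rpow (by linarith) (by linarith : w / 2 ≠ 0)] at h
  have h1 : Real.exp (-(2 * Real.pi)) ≤ Real.exp (-(2 * Real.pi * R ^ (w / 2)⁻¹)) := by
    exact Real.exp_le_exp.2 (by nlinarith [Real.pi_pos])
  have h2 : ‖normalized w b d g‖ * (R * Real.exp (-(2 * Real.pi))) ≤ S :=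
    le_trans (by gcongr) h
  have h3 : ‖normalized w b d g‖ * R = S * Real.exp (2 * Real.pi) + ‖normalized w b d g‖ := by
    rw [hR]; field_simp
  have h4 :
      (S * Real.exp (2 * Real.pi) + ‖normalized w b d g‖) * Real.exp (-(2 * Real.pi)) ≤ S := by
    rw [← h3]; linarith
  rw [add_mul, mul_assoc, ← Real.exp_add, add_neg_cancel, Real.exp_zero, mul_one] at h4
  have : 0 < ‖normalized w b d g‖ * Real.exp (-(2 * Real.pi)) := by positivity
  linarith

/-- An a priori bound `S` for `y ^ (w / 2) * |f|` improves, in the Siegel domain, to half of `S` and a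
multiple of the bound `ε` for the initial coefficients. -/
lemma rpow_im_mul_norm_le_of_initial_bound {X : Type} {b : ℚ → X → ℂ} {κ : X} {f : ℍ → ℂ}
    {w C A : ℝ}
    (hC0 : 0 < C) (hC : ∀ t : ℝ, 0 ≤ t → t ^ (w / 2) ≤ C * Real.exp t)
    (hA : A = 5 / 2 * C * Real.exp (2 * Real.pi))
    (hf : ∀ z : ℍ, HasSum (fun d : {d : ℚ // 0 < d} ↦
      b d κ * Complex.exp (2 * Real.pi * Complex.I * (d : ℚ) * z)) (f z))
    {S : ℝ} (hS : ∀ z : ℍ, z.im ^ (w / 2) * ‖f z‖ ≤ S)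
    {M : ℕ} (hM : 1 ≤ M) (hsupp : ∀ d : ℚ, 0 < d → b d κ ≠ 0 → ∃ n : ℤ, d = n / M)
    {ε : ℝ} (hε0 : 0 ≤ ε)
    (hε : ∀ d : ℚ, 0 < d → (d : ℝ) < Real.log M / Real.pi + A → ‖normalized w b d κ‖ ≤ ε)
    {z : ℍ} (hz : 4 / 5 ≤ z.im) :
    z.im ^ (w / 2) * ‖f z‖ ≤ 5 / 4 * C * M * ε + S / 2 := by
  have hM0 : (0 : ℝ) < M := by exact_mod_cast hM
  have hM1 : (1 : ℝ) ≤ M := by exact_mod_cast hM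
  have hA0 : 0 < A := by rw [hA]; positivity
  have hS0 : 0 ≤ S := le_trans (by have := z.im_pos; positivity) (hS z)
  have hπ : Real.pi < 3.15 := Real.pi_lt_d2
  have hπ3 : 3 < Real.pi := Real.pi_gt_three
  -- the bound for `|β_d| e ^ (-4 t)`, where `t = d y`, in the tail
  set η : ℝ := Real.exp (2 * Real.pi) * S * (Real.exp (-(Real.pi * A)) / M) with hη
  have hη0 : 0 ≤ η := by positivity
  have key : z.im ^ (w / 2) * ‖f z‖ ≤ ((ε + η) * C) * (M / z.im) := by
    refine rpow_im_mul_norm_le (hf z) hM hsupp (by positivity) fun d hd ↦ ?_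
    have hd' : (0 : ℝ) < d := by exact_mod_cast hd
    set t : ℝ := d * z.im with ht
    have ht0 : 0 ≤ t := by have := z.im_pos; positivity
    -- `6 < 2 π`, and `e ^ (-6 t)` is shared out between `t ^ (w / 2)`, the sum over `d` and the tail
    have h1 : t ^ (w / 2) * Real.exp (-(2 * Real.pi * t)) ≤
        C * (Real.exp (-(4 * t)) * Real.exp (-t)) := by
      calc t ^ (w / 2) * Real.exp (-(2 * Real.pi * t))
          ≤ (C * Real.exp t) * Real.exp (-(6 * t)) := by
            gcongr
            · exact hC t ht0
            · linarith
        _ = C * (Real.exp (-(4 * t)) * Real.exp (-t)) := by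
            rw [mul_assoc, ← Real.exp_add, ← Real.exp_add]; ring_nf
    have h2 : ‖normalized w b d κ‖ * Real.exp (-(4 * t)) ≤ ε + η := by
      rcases lt_or_ge (d : ℝ) (Real.log M / Real.pi + A) with hlt | hge
      · have h3 : Real.exp (-(4 * t)) ≤ 1 := Real.exp_le_one_iff.2 (by linarith)
        calc ‖normalized w b d κ‖ * Real.exp (-(4 * t)) ≤ ε * 1 := by
              gcongr
              exact hε d hd hlt
          _ ≤ ε + η := by linarith
      · have h3 := norm_normalized_mul_le hf hS hd one_pos
        rw [Real.one_rpow, one_mul, mul_one] at h3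
        have h4 : ‖normalized w b d κ‖ ≤ Real.exp (2 * Real.pi) * S := by
          calc ‖normalized w b d κ‖ = Real.exp (2 * Real.pi) *
                (‖normalized w b d κ‖ * Real.exp (-(2 * Real.pi))) := by
                rw [mul_left_comm, ← Real.exp_add]; simp
            _ ≤ _ := by gcongr
        have h5 : Real.exp (-(4 * t)) ≤ Real.exp (-(Real.pi * A)) / M := by
          have h6 : Real.exp (-(Real.pi * A)) / M = Real.exp (-(Real.pi * A) - Real.log M) := by
            rw [Real.exp_sub, Real.exp_log hM0]
          rw [h6]
          gcongr
          have h7 : Real.pi * (Real.log M / Real.pi + A) = Real.log M + Real.pi * A := by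
            field_simp
          have h8 : Real.pi * (Real.log M / Real.pi + A) ≤ Real.pi * d := by gcongr
          -- `4 * (4 / 5) > π`
          have h9 : Real.pi * d ≤ 4 * t := by rw [ht]; nlinarith
          linarith
        calc ‖normalized w b d κ‖ * Real.exp (-(4 * t))
            ≤ (Real.exp (2 * Real.pi) * S) * (Real.exp (-(Real.pi * A)) / M) := by gcongr
          _ ≤ ε + η := by linarith
    calc ‖normalized w b d κ‖ * (t ^ (w / 2) * Real.exp (-(2 * Real.pi * t)))
        ≤ ‖normalized w b d κ‖ * (C * (Real.exp (-(4 * t)) * Real.exp (-t))) := by gcongr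
      _ = (‖normalized w b d κ‖ * Real.exp (-(4 * t))) * C * Real.exp (-t) := by ring
      _ ≤ (ε + η) * C * Real.exp (-t) := by gcongr
  have hMy : (M : ℝ) / z.im ≤ 5 / 4 * M := by
    rw [div_le_iff₀ z.im_pos]
    nlinarith
  have hAe : A * Real.exp (-(Real.pi * A)) ≤ 1 := by
    have h1 : A ≤ Real.exp (Real.pi * A) := by
      have := Real.add_one_le_exp (Real.pi * A)
      nlinarith
    calc A * Real.exp (-(Real.pi * A)) ≤ Real.exp (Real.pi * A) * Real.exp (-(Real.pi * A)) := by
          gcongr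
      _ = 1 := by rw [← Real.exp_add]; simp
  calc z.im ^ (w / 2) * ‖f z‖ ≤ ((ε + η) * C) * (5 / 4 * M) := key.trans (by gcongr)
    _ = 5 / 4 * C * M * ε + (A * Real.exp (-(Real.pi * A))) * S / 2 := by
        rw [hη, hA]; field_simp; ring
    _ ≤ 5 / 4 * C * M * ε + 1 * S / 2 := by gcongr
    _ = _ := by ring

/-- The Sturm bound for a family of Fourier series `f g`, for `g` in a set `X`. The family plays the
role of an automorphic form on a group with finite part `X` and maximal compact subgroup `K`: each
value `y ^ (w / 2) * |f g z|` is also attained over `K` in a Siegel domain, and over `K` there are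
only finitely many functions `|f κ|`. -/
theorem exists_sturm_bound (w : ℝ) : ∃ A B : ℝ, 0 < A ∧ 0 < B ∧
    ∀ (X : Type) (K : Set X) (b : ℚ → X → ℂ) (f : X → ℍ → ℂ),
      (∀ (g : X) (z : ℍ), HasSum (fun d : {d : ℚ // 0 < d} ↦
        b d g * Complex.exp (2 * Real.pi * Complex.I * (d : ℚ) * z)) (f g z)) →
      (∀ (g : X) (z : ℍ), ∃ κ ∈ K, ∃ z' : ℍ, 4 / 5 ≤ z'.im ∧
        z.im ^ (w / 2) * ‖f g z‖ = z'.im ^ (w / 2) * ‖f κ z'‖) →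
      (∃ F : Finset X, (∀ κ ∈ F, κ ∈ K) ∧
        ∀ κ ∈ K, ∀ z : ℍ, ∃ κ' ∈ F, ‖f κ z‖ = ‖f κ' z‖) →
      ∀ M : ℕ, 1 ≤ M → SupportedIn K b M → ∀ ε : ℝ,
        (∀ κ ∈ K, ∀ d : ℚ, 0 < d → (d : ℝ) < Real.log M / Real.pi + A →
          ‖normalized w b d κ‖ ≤ ε) →
        ∀ (d : ℚ) (g : X), 0 < d → ‖normalized w b d g‖ ≤ ε * B * M := by
  set C : ℝ := (w / 2) ^ (w / 2) ⊔ 1 with hCdef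
  have hC0 : 0 < C := lt_max_of_lt_right one_pos
  refine ⟨5 / 2 * C * Real.exp (2 * Real.pi), 5 / 2 * C * Real.exp (2 * Real.pi), by positivity,
    by positivity, ?_⟩
  intro X K b f hf hred ⟨F, hFK, hF⟩ M hM hsupp ε hε d g hd
  have hM0 : (0 : ℝ) < M := by exact_mod_cast hM
  have hM1 : (1 : ℝ) ≤ M := by exact_mod_cast hM
  have hA0 : 0 < 5 / 2 * C * Real.exp (2 * Real.pi) := by positivity
  -- the bound `log M / π + A` is positive, so that there are initial coefficients
  have hε0 : 0 ≤ ε := by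
    obtain ⟨κ, hκ, -⟩ := hred g UpperHalfPlane.I
    have hT : 0 < Real.log M / Real.pi + 5 / 2 * C * Real.exp (2 * Real.pi) := by
      have := Real.log_nonneg hM1
      positivity
    obtain ⟨q, hq0, hq⟩ := exists_rat_btwn hT
    exact (norm_nonneg _).trans (hε κ hκ q (by exact_mod_cast hq0) hq)
  -- finiteness of the supremum
  choose! S₀ hS₀ using fun κ (hκ : κ ∈ K) ↦
    exists_rpow_im_mul_norm_le w (hf κ) hM (hsupp κ hκ)
  have hbdd : BddAbove (Set.range fun p : X × ℍ ↦ p.2.im ^ (w / 2) * ‖f p.1 p.2‖) := by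
    refine ⟨∑ κ ∈ F, |S₀ κ|, ?_⟩
    rintro _ ⟨⟨g, z⟩, rfl⟩
    obtain ⟨κ, hκ, z', hz', heq⟩ := hred g z
    obtain ⟨κ', hκ', heq'⟩ := hF κ hκ z'
    refine (heq.trans_le ?_)
    rw [heq']
    refine (hS₀ κ' (hFK κ' hκ') z' hz').trans ((le_abs_self _).trans ?_)
    exact Finset.single_le_sum (f := fun κ ↦ |S₀ κ|) (fun _ _ ↦ abs_nonneg _) hκ'
  set S := sSup (Set.range fun p : X × ℍ ↦ p.2.im ^ (w / 2) * ‖f p.1 p.2‖)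
  have hS : ∀ (g : X) (z : ℍ), z.im ^ (w / 2) * ‖f g z‖ ≤ S :=
    fun g z ↦ le_csSup hbdd ⟨(g, z), rfl⟩
  rcases lt_or_ge w 0 with hw | hw
  · rw [normalized_eq_zero_of_neg hw (hf g) (hS g) hd, norm_zero]
    positivity
  · have hC : ∀ t : ℝ, 0 ≤ t → t ^ (w / 2) ≤ C * Real.exp t := by
      intro t ht
      have h := rpow_le_const_mul_exp (a := w / 2) (by linarith) one_pos ht
      rw [div_one, one_mul] at h
      exact h.trans (by gcongr; exact le_max_left _ _)
    have hSle : S ≤ 5 / 4 * C * M * ε + S / 2 := by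
      refine csSup_le ⟨_, ⟨(g, UpperHalfPlane.I), rfl⟩⟩ ?_
      rintro _ ⟨⟨g', z⟩, rfl⟩
      obtain ⟨κ, hκ, z', hz', heq⟩ := hred g' z
      refine heq.trans_le ?_
      exact rpow_im_mul_norm_le_of_initial_bound hC0 hC rfl (hf κ) (hS κ) hM (hsupp κ hκ) hε0
        (hε κ hκ) hz'
    have h := norm_normalized_mul_le (hf g) (hS g) hd one_pos
    rw [Real.one_rpow, one_mul, mul_one] at h
    calc ‖normalized w b d g‖ = Real.exp (2 * Real.pi) *
          (‖normalized w b d g‖ * Real.exp (-(2 * Real.pi))) := by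
          rw [mul_left_comm, ← Real.exp_add]; simp
      _ ≤ Real.exp (2 * Real.pi) * (5 / 2 * C * M * ε) := by
          exact mul_le_mul_of_nonneg_left (by linarith) (Real.exp_pos _).le
      _ = _ := by ring

end SturmSL2

namespace SturmSL2

open UpperHalfPlane

/-! ### Forms on `SL₂(𝔸)` and on its double cover -/

lemma norm_denom_I (h : SL2 ℝ) :
    ‖denom h UpperHalfPlane.I‖ = ((h • UpperHalfPlane.I : ℍ).im) ^ (-1 / 2 : ℝ) := by
  have h0 : 0 < ‖denom h UpperHalfPlane.I‖ := norm_pos_iff.2 (denom_ne_zero _ _)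
  have h1 : (h • UpperHalfPlane.I : ℍ).im = 1 / ‖denom h UpperHalfPlane.I‖ ^ 2 := by
    have := im_smul_eq_div_normSq (h : GL (Fin 2) ℝ) UpperHalfPlane.I
    rw [Complex.normSq_eq_norm_sq] at this
    refine Eq.trans ?_ (this.trans ?_)
    · rfl
    · simp
  rw [h1, one_div, ← Real.rpow_natCast, ← Real.rpow_neg h0.le, ← Real.rpow_mul h0.le]
  norm_num

lemma norm_jHalf_I (g : MpReal) :
    ‖jHalf g UpperHalfPlane.I‖ = ((g.mat • UpperHalfPlane.I : ℍ).im) ^ (-1 / 4 : ℝ) := by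
  have h0 : denom g.mat UpperHalfPlane.I ≠ 0 := denom_ne_zero _ _
  have hs : ‖((g.sgn : ℤ) : ℂ)‖ = 1 := by
    rcases Int.units_eq_one_or g.sgn with h | h <;> simp [h]
  rw [jHalf, norm_mul, hs, one_mul, Complex.norm_conj,
    Complex.norm_cpow_of_ne_zero ((map_ne_zero _).2 h0), Complex.norm_conj, norm_denom_I,
    ← Real.rpow_mul (UpperHalfPlane.im_pos _).le]
  norm_num

/-- The Fourier expansion of a form, divided by the automorphy factor `J`. -/
lemma hasSum_of_hasSum_mul {c : {d : ℚ // 0 < d} → ℂ} {J Φ : ℂ} (hJ : J ≠ 0) {z : ℍ}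
    (h : HasSum (fun d ↦ c d * (J * Complex.exp (2 * Real.pi * Complex.I * (d : ℚ) * z))) Φ) :
    HasSum (fun d ↦ c d * Complex.exp (2 * Real.pi * Complex.I * (d : ℚ) * z)) (J⁻¹ * Φ) := by
  have heq : (fun d ↦ c d * Complex.exp (2 * Real.pi * Complex.I * (d : ℚ) * z)) = fun d ↦
      J⁻¹ * (c d * (J * Complex.exp (2 * Real.pi * Complex.I * (d : ℚ) * z))) := by
    funext d
    rw [mul_left_comm, inv_mul_cancel_left₀ hJ]
  rw [heq]
  exact h.mul_left J⁻¹

/-- The functions on the upper half plane attached to a form on `SL₂(𝔸)` satisfy the assumptions of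
`exists_sturm_bound`. -/
lemma IsCuspForm.exists_reduced_family {ℓ : ℤ} {φ : SL2 FinAdele × SL2 ℝ → ℂ}
    {b : ℚ → SL2 FinAdele → ℂ} (hφ : IsCuspForm ℓ φ) (hb : HasFourierExpansion ℓ φ b) :
    ∃ f : SL2 FinAdele → ℍ → ℂ,
      (∀ (g : SL2 FinAdele) (z : ℍ), HasSum (fun d : {d : ℚ // 0 < d} ↦
        b d g * Complex.exp (2 * Real.pi * Complex.I * (d : ℚ) * z)) (f g z)) ∧
      (∀ (g : SL2 FinAdele) (z : ℍ), ∃ κ ∈ integralSL2, ∃ z' : ℍ, 4 / 5 ≤ z'.im ∧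
        z.im ^ ((ℓ : ℝ) / 2) * ‖f g z‖ = z'.im ^ ((ℓ : ℝ) / 2) * ‖f κ z'‖) ∧
      (∃ F : Finset (SL2 FinAdele), (∀ κ ∈ F, κ ∈ integralSL2) ∧
        ∀ κ ∈ integralSL2, ∀ z : ℍ, ∃ κ' ∈ F, ‖f κ z‖ = ‖f κ' z‖) := by
  classical
  have hJ : ∀ h : SL2 ℝ, denom h UpperHalfPlane.I ^ (-ℓ) ≠ 0 :=
    fun h ↦ zpow_ne_zero _ (denom_ne_zero _ _)
  have hsum : ∀ (g : SL2 FinAdele) (h : SL2 ℝ), HasSum (fun d : {d : ℚ // 0 < d} ↦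
      b d g * Complex.exp (2 * Real.pi * Complex.I * (d : ℚ) * (h • UpperHalfPlane.I : ℍ)))
      ((denom h UpperHalfPlane.I ^ (-ℓ))⁻¹ * φ (g, h)) :=
    fun g h ↦ hasSum_of_hasSum_mul (hJ h) (hb g h)
  let f : SL2 FinAdele → ℍ → ℂ := fun g z ↦ ∑' d : {d : ℚ // 0 < d},
    b d g * Complex.exp (2 * Real.pi * Complex.I * (d : ℚ) * z)
  have hfφ : ∀ (g : SL2 FinAdele) (h : SL2 ℝ), f g (h • UpperHalfPlane.I) =
      (denom h UpperHalfPlane.I ^ (-ℓ))⁻¹ * φ (g, h) :=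
    fun g h ↦ (hsum g h).tsum_eq
  have hnorm : ∀ g (h : SL2 ℝ), (h • UpperHalfPlane.I : ℍ).im ^ ((ℓ : ℝ) / 2) *
      ‖f g (h • UpperHalfPlane.I)‖ = ‖φ (g, h)‖ := by
    intro g h
    have hy := (h • UpperHalfPlane.I : ℍ).im_pos
    rw [hfφ, norm_mul, norm_inv, norm_zpow, norm_denom_I, ← Real.rpow_intCast,
      ← Real.rpow_mul hy.le, ← Real.rpow_neg hy.le, ← mul_assoc, ← Real.rpow_add hy]
    push_cast
    ring_nf
    simp
  refine ⟨f, fun g z ↦ ?_, fun g z ↦ ?_, ?_⟩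
  · obtain ⟨h, rfl⟩ := MulAction.exists_smul_eq (SL2 ℝ) UpperHalfPlane.I z
    rw [hfφ]
    exact hsum g h
  · obtain ⟨h, rfl⟩ := MulAction.exists_smul_eq (SL2 ℝ) UpperHalfPlane.I z
    obtain ⟨γ, hγ, him⟩ := exists_rat_smul_mem_siegel g h
    refine ⟨_, hγ, _, him, ?_⟩
    rw [hnorm, hnorm, ← hφ.left_invariant γ (g, h)]
    rfl
  · obtain ⟨U, hU, hinv⟩ := hφ.smooth
    obtain ⟨F, hF⟩ := exists_finset_integralSL2_cosets U hU
    refine ⟨F.filter (· ∈ integralSL2), fun κ hκ ↦ (Finset.mem_filter.1 hκ).2, fun κ hκ z ↦ ?_⟩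
    obtain ⟨κ', hκ'F, hκ', u, hu, rfl⟩ := hF κ hκ
    refine ⟨κ', Finset.mem_filter.2 ⟨hκ'F, hκ'⟩, ?_⟩
    obtain ⟨h, rfl⟩ := MulAction.exists_smul_eq (SL2 ℝ) UpperHalfPlane.I z
    have := hinv u hu (κ', h)
    rw [Prod.mk_mul_mk, mul_one] at this
    rw [hfφ, hfφ, this]

/-- The functions on the upper half plane attached to a form on the double cover of `SL₂(𝔸)` satisfy
the assumptions of `exists_sturm_bound`. -/
lemma IsMpCuspForm.exists_reduced_family {k : ℤ} {φ : MpAdele → ℂ} {b : ℚ → MpFin → ℂ}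
    (hφ : IsMpCuspForm k φ) (hb : HasMpFourierExpansion k φ b) :
    ∃ f : MpFin → ℍ → ℂ,
      (∀ (g : MpFin) (z : ℍ), HasSum (fun d : {d : ℚ // 0 < d} ↦
        b d g * Complex.exp (2 * Real.pi * Complex.I * (d : ℚ) * z)) (f g z)) ∧
      (∀ (g : MpFin) (z : ℍ), ∃ κ ∈ MpFin.integral, ∃ z' : ℍ, 4 / 5 ≤ z'.im ∧
        z.im ^ ((k : ℝ) / 2 / 2) * ‖f g z‖ = z'.im ^ ((k : ℝ) / 2 / 2) * ‖f κ z'‖) ∧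
      (∃ F : Finset MpFin, (∀ κ ∈ F, κ ∈ MpFin.integral) ∧
        ∀ κ ∈ MpFin.integral, ∀ z : ℍ, ∃ κ' ∈ F, ‖f κ z‖ = ‖f κ' z‖) := by
  classical
  have hJ : ∀ h : MpReal, jHalf h UpperHalfPlane.I ^ (-k) ≠ 0 := by
    intro h
    refine zpow_ne_zero _ (norm_pos_iff.1 ?_)
    rw [norm_jHalf_I]
    have := (h.mat • UpperHalfPlane.I : ℍ).im_pos
    positivity
  have hsum : ∀ (g : MpFin) (h : MpReal), HasSum (fun d : {d : ℚ // 0 < d} ↦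
      b d g * Complex.exp (2 * Real.pi * Complex.I * (d : ℚ) * (h.mat • UpperHalfPlane.I : ℍ)))
      ((jHalf h UpperHalfPlane.I ^ (-k))⁻¹ * φ (MpAdele.ofParts g h)) :=
    fun g h ↦ hasSum_of_hasSum_mul (hJ h) (hb g h)
  let f : MpFin → ℍ → ℂ := fun g z ↦ ∑' d : {d : ℚ // 0 < d},
    b d g * Complex.exp (2 * Real.pi * Complex.I * (d : ℚ) * z)
  have hfφ : ∀ (g : MpFin) (h : MpReal), f g (h.mat • UpperHalfPlane.I) =
      (jHalf h UpperHalfPlane.I ^ (-k))⁻¹ * φ (MpAdele.ofParts g h) :=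
    fun g h ↦ (hsum g h).tsum_eq
  have hnorm : ∀ (g : MpFin) (h : MpReal), (h.mat • UpperHalfPlane.I : ℍ).im ^ ((k : ℝ) / 2 / 2) *
      ‖f g (h.mat • UpperHalfPlane.I)‖ = ‖φ (MpAdele.ofParts g h)‖ := by
    intro g h
    have hy := (h.mat • UpperHalfPlane.I : ℍ).im_pos
    rw [hfφ, norm_mul, norm_inv, norm_zpow, norm_jHalf_I, ← Real.rpow_intCast,
      ← Real.rpow_mul hy.le, ← Real.rpow_neg hy.le, ← mul_assoc, ← Real.rpow_add hy]
    push_cast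
    ring_nf
    simp
  refine ⟨f, fun g z ↦ ?_, fun g z ↦ ?_, ?_⟩
  · obtain ⟨h, rfl⟩ := MulAction.exists_smul_eq (SL2 ℝ) UpperHalfPlane.I z
    have := hsum g ⟨h, 1⟩
    rwa [← hfφ] at this
  · obtain ⟨h, rfl⟩ := MulAction.exists_smul_eq (SL2 ℝ) UpperHalfPlane.I z
    obtain ⟨γ, hγ, him⟩ := exists_rat_smul_mem_siegel g.mat h
    -- the sign of the translate is moved to the finite part
    obtain ⟨s, hs⟩ : ∃ s : ℤˣ, MpAdele.ofRat γ * MpAdele.ofParts g ⟨h, 1⟩ =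
        MpAdele.ofParts ⟨ratToFin γ * g.mat, s⟩ ⟨ratToReal γ * h, 1⟩ :=
      ⟨(MpAdele.ofRat γ * MpAdele.ofParts g ⟨h, 1⟩).sgn, by
        conv_rhs => rw [MpAdele.ofParts, mul_one]
        rfl⟩
    refine ⟨⟨ratToFin γ * g.mat, s⟩, hγ, _, him, ?_⟩
    have h1 := hnorm g ⟨h, 1⟩
    have h2 := hnorm ⟨ratToFin γ * g.mat, s⟩ ⟨ratToReal γ * h, 1⟩
    rw [← hs, hφ.left_invariant] at h2
    exact h1.trans h2.symm
  · obtain ⟨U, hU, hinv⟩ := hφ.smooth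
    obtain ⟨F, hF⟩ := exists_finset_integralSL2_cosets U hU
    refine ⟨((F.filter (· ∈ integralSL2)) ×ˢ (Finset.univ : Finset ℤˣ)).image
      fun p ↦ ⟨p.1, p.2⟩, fun κ hκ ↦ ?_, fun κ hκ z ↦ ?_⟩
    · obtain ⟨p, hp, rfl⟩ := Finset.mem_image.1 hκ
      exact (Finset.mem_filter.1 (Finset.mem_product.1 hp).1).2
    · obtain ⟨m, s⟩ := κ
      obtain ⟨κ', hκ'F, hκ', u, hu, rfl⟩ := hF m hκ
      obtain ⟨h, rfl⟩ := MulAction.exists_smul_eq (SL2 ℝ) UpperHalfPlane.I z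
      -- right translation by `(u, 1)` changes the sign by a value of the cocycle
      set c : ℤˣ := finCocycle κ' u * kubota h 1 with hc
      refine ⟨⟨κ', s * c⟩, Finset.mem_image.2 ⟨(κ', s * c),
        Finset.mem_product.2 ⟨Finset.mem_filter.2 ⟨hκ'F, hκ'⟩, Finset.mem_univ _⟩, rfl⟩, ?_⟩
      have h1 : MpAdele.ofParts ⟨κ', s * c⟩ ⟨h, 1⟩ * MpAdele.ofParts ⟨u, 1⟩ ⟨1, 1⟩ =
          MpAdele.ofParts ⟨κ' * u, s⟩ ⟨h, 1⟩ := by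
        change MpAdele.mk (κ' * u) (h * 1) (s * c * 1 * (1 * 1) * c) = MpAdele.mk (κ' * u) h (s * 1)
        rw [mul_one, mul_one, mul_one, mul_one, mul_one, mul_assoc, Int.units_mul_self, mul_one]
      have h2 := hinv u hu (MpAdele.ofParts ⟨κ', s * c⟩ ⟨h, 1⟩)
      rw [h1] at h2
      have h3 := hfφ ⟨κ' * u, s⟩ ⟨h, 1⟩
      rw [h2, ← hfφ] at h3
      exact congrArg norm h3

end SturmSL2

theorem theorem12p1 (k : ℤ) :
    ∃ A B : ℝ, 0 < A ∧ 0 < B ∧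
      -- forms of weight `k / 2` on the metaplectic double cover
      (∀ (φ : SturmSL2.MpAdele → ℂ) (b : ℚ → SturmSL2.MpFin → ℂ),
        SturmSL2.IsMpCuspForm k φ → SturmSL2.HasMpFourierExpansion k φ b →
        ∀ M : ℕ, 1 ≤ M → SturmSL2.SupportedIn SturmSL2.MpFin.integral b M →
        ∀ ε : ℝ,
          (∀ κ ∈ SturmSL2.MpFin.integral, ∀ d : ℚ, 0 < d → (d : ℝ) < Real.log M / Real.pi + A →
            ‖SturmSL2.normalized ((k : ℝ) / 2) b d κ‖ ≤ ε) →
          ∀ (d : ℚ) (gf : SturmSL2.MpFin), 0 < d →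
            ‖SturmSL2.normalized ((k : ℝ) / 2) b d gf‖ ≤ ε * B * M) ∧
      -- forms of weight `ℓ = k / 2` on the linear group, when `k` is even
      (∀ ℓ : ℤ, k = 2 * ℓ →
        ∀ (φ : SturmSL2.SL2 SturmSL2.FinAdele × SturmSL2.SL2 ℝ → ℂ)
          (b : ℚ → SturmSL2.SL2 SturmSL2.FinAdele → ℂ),
        SturmSL2.IsCuspForm ℓ φ → SturmSL2.HasFourierExpansion ℓ φ b →
        ∀ M : ℕ, 1 ≤ M → SturmSL2.SupportedIn SturmSL2.integralSL2 b M →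
        ∀ ε : ℝ,
          (∀ κ ∈ SturmSL2.integralSL2, ∀ d : ℚ, 0 < d → (d : ℝ) < Real.log M / Real.pi + A →
            ‖SturmSL2.normalized (ℓ : ℝ) b d κ‖ ≤ ε) →
          ∀ (d : ℚ) (gf : SturmSL2.SL2 SturmSL2.FinAdele), 0 < d →
            ‖SturmSL2.normalized (ℓ : ℝ) b d gf‖ ≤ ε * B * M) := by
  obtain ⟨A, B, hA, hB, h⟩ := SturmSL2.exists_sturm_bound ((k : ℝ) / 2)
  refine ⟨A, B, hA, hB, fun φ b hφ hb ↦ ?_, fun ℓ hℓ φ b hφ hb ↦ ?_⟩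
  · obtain ⟨f, hf, hred, hF⟩ := hφ.exists_reduced_family hb
    exact h _ _ b f hf hred hF
  · have hw : (k : ℝ) / 2 = ℓ := by rw [hℓ]; push_cast; ring
    rw [hw] at h
    obtain ⟨f, hf, hred, hF⟩ := hφ.exists_reduced_family hb
    exact h _ _ b f hf hred hF
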